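/- Let $d \ge 1$. A closed halfspace of $\mathbb{R}^d$ is a set $\{x : \langle u, x\rangle \ge b\}$ with $u \ne 0$. For a finite nonempty set $X \subset \mathbb{R}^d$ and a point $q \in \mathbb{R}^d$, the Tukey depth is $\tau_X(q) = \frac{1}{|X|}\min_H |X \cap H|$, and for a Borel probability measure $\mu$ on $\mathbb{R}^d$ it is $\tau_\mu(q) = \inf_H \mu(H)$, where $H$ ranges over all closed halfspaces that contain $q$. Theorem (Depth Carathéodory's theorem). For every $d \ge 1$ and every $\tau > 0$ there is a constant $c = c(d,\tau) > 0$, depending only on $d$ and $\tau$, such that the following two statements hold. (1) Let $X \subset \mathbb{R}^d$ be a finite set of points and let $q \in \mathbb{R}^d$ satisfy $\tau_X(q) = \tau$. Then there are subsets $X_1, \dots, X_{d+1}$ of $X$, each with at least $c|X|$ points, such that $q \in \operatorname{Conv}(\{x_1, \dots, x_{d+1}\})$ for every choice of points $x_i \in X_i$. If $|X| \ge d+1$, then $X_1, \dots, X_{d+1}$ can moreover be taken pairwise disjoint. (2) Let $\mu$ be a Borel probability measure on $\mathbb{R}^d$ and let $q \in \mathbb{R}^d$ satisfy $\tau_\mu(q)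 = \tau$. Then there are Borel sets $X_1, \dots, X_{d+1} \subseteq \mathbb{R}^d$ with $\mu(X_i) \ge c$ for every $i$, such that $q \in \operatorname{Conv}(\{x_1, \dots, x_{d+1}\})$ for every choice of points $x_i \in X_i$. If $\mu(\{x\}) \le \frac{1}{d+1}$ for every $x \in \mathbb{R}^d$ (in particular, if $\mu$ has no atoms), then $X_1, \dots, X_{d+1}$ can moreover be taken pairwise disjoint. -/

import Mathlib

open MeasureTheory

noncomputable section

/-- Closed halfspaces of `ℝ^d`. -/
def IsClosedHalfspace {d : ℕ} (H : Set (EuclideanSpace ℝ (Fin d))) : Prop :=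
  ∃ (u : EuclideanSpace ℝ (Fin d)) (b : ℝ), u ≠ 0 ∧ H = {x | b ≤ inner ℝ u x}

/-- The minimum number of points of `X` in a closed halfspace that contains `q`. -/
def tukeyCount {d : ℕ} (X : Finset (EuclideanSpace ℝ (Fin d)))
    (q : EuclideanSpace ℝ (Fin d)) : ℕ :=
  sInf {k | ∃ H, IsClosedHalfspace H ∧ q ∈ H ∧ k = ((X : Set (EuclideanSpace ℝ (Fin d))) ∩ H).ncard}

/-- The (normalized) Tukey depth of `q` with respect to the finite point set `X`. -/
def tukeyDepth {d : ℕ} (X : Finset (EuclideanSpace ℝ (Fin d)))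
    (q : EuclideanSpace ℝ (Fin d)) : ℝ :=
  (tukeyCount X q : ℝ) / (X.card : ℝ)

/-- The Tukey depth of `q` with respect to a measure `μ`: the infimum of `μ(H)` over all closed
halfspaces `H` that contain `q`. -/
def measureTukeyDepth {d : ℕ} (μ : Measure (EuclideanSpace ℝ (Fin d)))
    (q : EuclideanSpace ℝ (Fin d)) : ℝ :=
  sInf {t | ∃ H, IsClosedHalfspace H ∧ q ∈ H ∧ t = μ.real H}

/-- `q` lies in `Conv {x_1, …, x_{d+1}}` for every choice of points `x_i ∈ Y_i`. -/
def InEveryTransversalHull {d : ℕ} (q : EuclideanSpace ℝ (Fin d))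
    (Y : Fin (d + 1) → Set (EuclideanSpace ℝ (Fin d))) : Prop :=
  ∀ x : Fin (d + 1) → EuclideanSpace ℝ (Fin d), (∀ i, x i ∈ Y i) →
    q ∈ convexHull ℝ (Set.range x)

end

/-!
Translate `q` to the origin and let `X` be the resulting random vector. Four ingredients give the
theorem; all constants depend on the dimension and on `τ` only.

* A weak form of the Yao–Yao theorem (`exists_avoidedCells`): every mass distribution has boundedly
  many cells of a fixed fraction of the mass, each in the relative interior of a finitely generated
  cone, such that every hyperplane through the origin leaves the generators of one of them on one
  side. Instead of the topological center of Yao and Yao, the induction on the dimension uses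
  centerpoints: after central projection, a median hyperplane splits the mass into two halves;
  projecting along the line through the centerpoints of the halves makes these coincide, and the
  claim follows from the next item in two dimensions less.
* Cells for deep halfspaces (`AvoidedCells.exists_containedCells`): iterating the first item on the
  complement of a cell gives boundedly many cells such that every halfspace of mass at least `τ`
  contains one of them. Hence, if the origin has depth at least `τ`, every transversal of these
  cells has the origin in its convex hull.
* A same-type lemma (`exists_constant_signs`): shrinking the cells to fixed fractions, one can make
  the signs of all minors of the matrix of a transversal constant. Variables are eliminated one at a
  time, replacing a vector by the generators of a cell that decides the signs.
* Minors detect positive circuits (`positive_circuit_of_sign_eq`). By Carathéodory's theorem, one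
  transversal has a minimal subfamily with the origin in its convex hull; as the signs of the minors
  agree, the same indices serve for all transversals. The minimal family consists of `r + 1 ≤ d + 1`
  sets, which are automatically disjoint, since a repeated point would make a proper subfamily
  dependent.

If no atom is heavier than `1 / (d + 1)`, further disjoint sets can be split off until there are
`d + 1` of them (`exists_disjoint_completion`). Finite sets are the case of uniform measures, where
the atoms have mass `1 / |X|`.
-/

/-! ### Finite measures on the line: exhaustion and medians -/

theorem exists_lt_measureReal_of_lt_iUnion {Ω : Type*} [MeasurableSpace Ω] (μ : Measure Ω)
    [IsFiniteMeasure μ] {s : ℕ → Set Ω} (hs : Monotone s) {a : ℝ}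
    (ha : a < μ.real (⋃ n, s n)) : ∃ n, a < μ.real (s n) := by
  have h := (ENNReal.tendsto_toReal (measure_ne_top μ _)).comp
    (tendsto_measure_iUnion_atTop (μ := μ) hs)
  exact (h.eventually (lt_mem_nhds ha)).exists

theorem exists_median {Ω : Type*} [MeasurableSpace Ω] (μ : Measure Ω) [IsFiniteMeasure μ]
    {f : Ω → ℝ} (hf : Measurable f) :
    ∃ b : ℝ, μ.real {ω | f ω < b} ≤ μ.real Set.univ / 2 ∧
      μ.real {ω | b < f ω} ≤ μ.real Set.univ / 2 := by
  rcases eq_or_lt_of_le (measureReal_nonneg (μ := μ) (s := Set.univ)) with h0 | hpos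
  · refine ⟨0, ?_, ?_⟩ <;>
    · rw [← h0, zero_div, h0]
      exact measureReal_mono (Set.subset_univ _)
  set M := μ.real Set.univ with hM
  have hle : ∀ t, μ.real {ω | f ω ≤ t} + μ.real {ω | t < f ω} = M := by
    intro t
    have := measureReal_add_measureReal_compl (μ := μ) (measurableSet_le hf (measurable_const (a := t)))
    have h2 : {ω | f ω ≤ t}ᶜ = {ω | t < f ω} := by ext; simp
    rwa [h2] at this
  set S : Set ℝ := {t | M / 2 ≤ μ.real {ω | f ω ≤ t}} with hS
  have hup : ∀ t ∈ S, ∀ t', t ≤ t' → t' ∈ S := fun t ht t' htt' =>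
    le_trans ht (measureReal_mono fun ω (h : f ω ≤ t) => h.trans htt')
  have hne : S.Nonempty := by
    have hU : (⋃ n : ℕ, {ω | f ω ≤ n}) = Set.univ := by
      ext ω; simpa using exists_nat_ge (f ω)
    obtain ⟨n, hn⟩ := exists_lt_measureReal_of_lt_iUnion μ (s := fun n : ℕ => {ω | f ω ≤ n})
      (fun a b hab ω (h : f ω ≤ a) => h.trans (Nat.cast_le.2 hab)) (a := M / 2)
      (by rw [hU]; linarith)
    exact ⟨n, hn.le⟩
  have hbdd : BddBelow S := by
    have hU : (⋃ n : ℕ, {ω | -(n : ℝ) < f ω}) = Set.univ := by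
      ext ω
      obtain ⟨n, hn⟩ := exists_nat_gt (-f ω)
      simpa using ⟨n, by linarith⟩
    obtain ⟨n, hn⟩ := exists_lt_measureReal_of_lt_iUnion μ (s := fun n : ℕ => {ω | -(n : ℝ) < f ω})
      (fun a b hab ω (h : -(a : ℝ) < f ω) => by
        have : (a : ℝ) ≤ b := Nat.cast_le.2 hab
        show -(b : ℝ) < f ω
        linarith) (a := M / 2)
      (by rw [hU]; linarith)
    refine ⟨-(n : ℝ), fun t ht => ?_⟩
    by_contra! hlt
    have h1 : M / 2 ≤ μ.real {ω | f ω ≤ -(n : ℝ)} := hup t ht _ hlt.le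
    have := hle (-(n : ℝ))
    linarith
  refine ⟨sInf S, ?_, ?_⟩
  · by_contra! hlt
    have hU : (⋃ n : ℕ, {ω | f ω ≤ sInf S - 1 / ((n : ℝ) + 1)}) = {ω | f ω < sInf S} := by
      ext ω
      simp only [Set.mem_iUnion, Set.mem_ofPred_eq]
      constructor
      · rintro ⟨n, hn⟩
        have : 0 < 1 / ((n : ℝ) + 1) := by positivity
        linarith
      · intro h
        obtain ⟨n, hn⟩ := exists_nat_one_div_lt (sub_pos.2 h)
        exact ⟨n, by linarith⟩
    obtain ⟨n, hn⟩ := exists_lt_measureReal_of_lt_iUnion μ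
      (s := fun n : ℕ => {ω | f ω ≤ sInf S - 1 / ((n : ℝ) + 1)})
      (fun a b hab ω (h : f ω ≤ _) => by
        have := Nat.one_div_le_one_div (α := ℝ) hab
        show f ω ≤ _
        linarith) (by rw [hU]; exact hlt)
    have h1 : sInf S ≤ sInf S - 1 / ((n : ℝ) + 1) := csInf_le hbdd hn.le
    have : 0 < 1 / ((n : ℝ) + 1) := by positivity
    linarith
  · by_contra! hlt
    have hU : (⋃ n : ℕ, {ω | sInf S + 1 / ((n : ℝ) + 1) < f ω}) = {ω | sInf S < f ω} := by
      ext ω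
      simp only [Set.mem_iUnion, Set.mem_ofPred_eq]
      constructor
      · rintro ⟨n, hn⟩
        have : 0 < 1 / ((n : ℝ) + 1) := by positivity
        linarith
      · intro h
        obtain ⟨n, hn⟩ := exists_nat_one_div_lt (sub_pos.2 h)
        exact ⟨n, by linarith⟩
    obtain ⟨n, hn⟩ := exists_lt_measureReal_of_lt_iUnion μ
      (s := fun n : ℕ => {ω | sInf S + 1 / ((n : ℝ) + 1) < f ω})
      (fun a b hab ω (h : _ < f ω) => by
        have := Nat.one_div_le_one_div (α := ℝ) hab
        show _ < f ω
        linarith) (by rw [hU]; exact hlt)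
    have hp : 0 < 1 / ((n : ℝ) + 1) := by positivity
    obtain ⟨t, htS, ht⟩ := exists_lt_of_csInf_lt hne
      (show sInf S < sInf S + 1 / ((n : ℝ) + 1) by linarith)
    have h1 : M / 2 ≤ μ.real {ω | f ω ≤ sInf S + 1 / ((n : ℝ) + 1)} := hup t htS _ ht.le
    have := hle (sInf S + 1 / ((n : ℝ) + 1))
    linarith

/-! ### Centerpoints -/

/-- Centerpoints in a linear setting: `X` takes values in the affine hyperplane `s = 1`, and some
point `c` of this hyperplane is deep among the values of `X`. By Helly's theorem, the halfspaces that
carry nearly all of the mass have a common point, once they are cut with a large ball. -/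
theorem exists_centerpoint_pi (m : ℕ) {Ω : Type*} [MeasurableSpace Ω] (μ : Measure Ω)
    [IsFiniteMeasure μ] (hμ : 0 < μ.real Set.univ) {X : Ω → Fin m → ℝ} (hX : Measurable X)
    (s : Module.Dual ℝ (Fin m → ℝ)) (hs : ∀ ω, s (X ω) = 1) :
    ∃ c, s c = 1 ∧ ∀ u : Module.Dual ℝ (Fin m → ℝ), 0 ≤ u c →
      1 / (2 * ((m : ℝ) + 1)) * μ.real Set.univ ≤ μ.real {ω | 0 ≤ u (X ω)} := by
  set M := μ.real Set.univ with hM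
  set δ := 1 / (2 * ((m : ℝ) + 1)) * M with hδ
  have hδ0 : 0 < δ := by positivity
  have hδM : ((m : ℝ) + 1) * (2 * δ) = M := by rw [hδ]; field_simp
  have hcont : ∀ u : Module.Dual ℝ (Fin m → ℝ), Continuous u :=
    fun u => LinearMap.continuous_of_finiteDimensional u
  have hmeas : ∀ u : Module.Dual ℝ (Fin m → ℝ), Measurable fun ω => u (X ω) :=
    fun u => (hcont u).measurable.comp hX
  have hcompl : ∀ {A : Set Ω}, MeasurableSet A → μ.real Aᶜ = M - μ.real A := fun hA => by
    have := measureReal_add_measureReal_compl (μ := μ) hA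
    linarith
  -- a ball carrying almost all of the mass makes the halfspaces compact
  obtain ⟨R, hR⟩ : ∃ R : ℝ, M - δ < μ.real {ω | ‖X ω‖ ≤ R} := by
    have hU : (⋃ n : ℕ, {ω | ‖X ω‖ ≤ n}) = Set.univ := by
      ext ω; simpa using exists_nat_ge ‖X ω‖
    obtain ⟨n, hn⟩ := exists_lt_measureReal_of_lt_iUnion μ (s := fun n : ℕ => {ω | ‖X ω‖ ≤ n})
      (fun a b hab ω (h : ‖X ω‖ ≤ a) => h.trans (Nat.cast_le.2 hab)) (a := M - δ)
      (by rw [hU]; linarith)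
    exact ⟨n, hn⟩
  have hRm : MeasurableSet {ω | ‖X ω‖ ≤ R} := measurableSet_le hX.norm measurable_const
  let B : Module.Dual ℝ (Fin m → ℝ) → Set Ω := fun u => {ω | ‖X ω‖ ≤ R} ∩ {ω | 0 ≤ u (X ω)}
  have hBm : ∀ u, MeasurableSet (B u) := fun u =>
    hRm.inter (measurableSet_le measurable_const (hmeas u))
  let F : {u // μ.real (B u)ᶜ < 2 * δ} → Set (Fin m → ℝ) := fun u =>
    Metric.closedBall 0 R ∩ ({x | s x = 1} ∩ {x | 0 ≤ u.1 x})
  obtain ⟨c, hc⟩ : (⋂ u, F u).Nonempty := by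
    refine Convex.helly_theorem_compact' (𝕜 := ℝ) (fun u => ?_) (fun u => ?_) fun I hI => ?_
    · refine (convex_closedBall 0 R).inter (Convex.inter ?_ ?_)
      · exact convex_hyperplane s.isLinear 1
      · exact convex_halfSpace_ge u.1.isLinear 0
    · refine (isCompact_closedBall 0 R).inter_right (IsClosed.inter ?_ ?_)
      · exact isClosed_eq (hcont s) continuous_const
      · exact isClosed_le continuous_const (hcont u.1)
    · rw [Module.finrank_fin_fun] at hI
      have hlt : μ.real (⋃ u ∈ I, (B u.1)ᶜ) < M := by
        refine lt_of_le_of_lt (measureReal_biUnion_finset_le _ _) ?_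
        rcases I.eq_empty_or_nonempty with rfl | hne
        · simpa using hμ
        · refine lt_of_lt_of_le (Finset.sum_lt_sum_of_nonempty hne fun u _ => u.2) ?_
          rw [Finset.sum_const, nsmul_eq_mul, ← hδM]
          have : (I.card : ℝ) ≤ m + 1 := by exact_mod_cast hI
          gcongr
      obtain ⟨ω, hω⟩ : ∃ ω, ω ∉ ⋃ u ∈ I, (B u.1)ᶜ := by
        by_contra! h
        rw [Set.eq_univ_of_forall h] at hlt
        exact lt_irrefl _ hlt
      refine ⟨X ω, ?_⟩
      simp only [Set.mem_iUnion, Set.mem_compl_iff, not_exists, not_not] at hω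
      refine Set.mem_iInter₂.2 fun u hu => ⟨?_, hs ω, (hω u hu).2⟩
      simpa using (hω u hu).1
  have hc' := fun u => Set.mem_iInter.1 hc u
  have hball : ∀ u : Module.Dual ℝ (Fin m → ℝ), M - δ < μ.real {ω | 0 ≤ u (X ω)} → 0 ≤ u c := by
    intro u hu
    refine (hc' ⟨u, ?_⟩).2.2
    have hum : MeasurableSet {ω | 0 ≤ u (X ω)} := measurableSet_le measurable_const (hmeas u)
    rw [Set.compl_inter]
    refine (measureReal_union_le _ _).trans_lt ?_
    rw [hcompl hRm, hcompl hum]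
    linarith
  have hsc : s c = 1 := by
    refine (hc' ⟨0, ?_⟩).2.1
    have : B 0 = {ω | ‖X ω‖ ≤ R} := by ext; simp [B]
    rw [this, hcompl hRm]
    linarith
  refine ⟨c, hsc, fun u hu => ?_⟩
  by_contra! hlt
  -- otherwise a slightly smaller open halfspace on the other side of `c` is still heavy
  have hneg : M - δ < μ.real {ω | u (X ω) < 0} := by
    have := hcompl (measurableSet_le measurable_const (hmeas u) : MeasurableSet {ω | 0 ≤ u (X ω)})
    have h2 : {ω | 0 ≤ u (X ω)}ᶜ = {ω | u (X ω) < 0} := by ext; simp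
    rw [h2] at this
    linarith
  have hU : (⋃ n : ℕ, {ω | u (X ω) ≤ -(1 / ((n : ℝ) + 1))}) = {ω | u (X ω) < 0} := by
    ext ω
    simp only [Set.mem_iUnion, Set.mem_ofPred_eq]
    constructor
    · rintro ⟨n, hn⟩
      have : 0 < 1 / ((n : ℝ) + 1) := by positivity
      linarith
    · intro h
      obtain ⟨n, hn⟩ := exists_nat_one_div_lt (neg_pos.2 h)
      exact ⟨n, by linarith⟩
  obtain ⟨n, hn⟩ := exists_lt_measureReal_of_lt_iUnion μ
    (s := fun n : ℕ => {ω | u (X ω) ≤ -(1 / ((n : ℝ) + 1))})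
    (fun a b hab ω (h : u (X ω) ≤ _) => by
      have := Nat.one_div_le_one_div (α := ℝ) hab
      show u (X ω) ≤ _
      linarith) (by rw [hU]; exact hneg)
  have hp : 0 < 1 / ((n : ℝ) + 1) := by positivity
  have := hball (-u - (1 / ((n : ℝ) + 1)) • s) (hn.trans_le (measureReal_mono fun ω hω => by
    simp only [Set.mem_ofPred_eq, LinearMap.sub_apply, LinearMap.neg_apply, LinearMap.smul_apply,
      hs, smul_eq_mul, mul_one] at hω ⊢
    linarith))
  simp only [LinearMap.sub_apply, LinearMap.neg_apply, LinearMap.smul_apply, hsc,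
    smul_eq_mul, mul_one] at this
  linarith

theorem exists_centerpoint {V : Type*} [AddCommGroup V] [Module ℝ V] [FiniteDimensional ℝ V]
    {Ω : Type*} [MeasurableSpace Ω] (μ : Measure Ω)
    [IsFiniteMeasure μ] (hμ : 0 < μ.real Set.univ) {X : Ω → V}
    (hX : ∀ u : Module.Dual ℝ V, Measurable fun ω => u (X ω))
    (s : Module.Dual ℝ V) (hs : ∀ ω, s (X ω) = 1) :
    ∃ c, s c = 1 ∧ ∀ u : Module.Dual ℝ V, 0 ≤ u c →
      1 / (2 * ((Module.finrank ℝ V : ℝ) + 1)) * μ.real Set.univ ≤ μ.real {ω | 0 ≤ u (X ω)} := by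
  let e := (Module.finBasis ℝ V).equivFun
  obtain ⟨c, hc1, hc⟩ := exists_centerpoint_pi _ μ hμ (X := fun ω => e (X ω))
    (measurable_pi_iff.2 fun i => hX ((LinearMap.proj i).comp e.toLinearMap))
    (s.comp e.symm.toLinearMap) (by simpa using hs)
  refine ⟨e.symm c, by simpa using hc1, fun u hu => ?_⟩
  simpa using hc (u.comp e.symm.toLinearMap) (by simpa using hu)

/-! ### Cells spanned by finitely many generators -/

/-- The relative interior of the convex cone generated by `S`, described by duality: a functional
that is nonnegative on `S` is nonnegative at `x`, and it vanishes at `x` only if it vanishes on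
`S`. -/
def relintCone {V : Type*} [AddCommGroup V] [Module ℝ V] (S : Finset V) : Set V :=
  {x | ∀ u : Module.Dual ℝ V, (∀ v ∈ S, 0 ≤ u v) → 0 ≤ u x ∧ (u x = 0 → ∀ v ∈ S, u v = 0)}

/-- The hyperplane `u = 0` does not separate the points of `S`: they all lie in one of its two
closed sides. -/
def Avoids {V : Type*} [AddCommGroup V] [Module ℝ V] (u : Module.Dual ℝ V) (S : Finset V) : Prop :=
  (∀ v ∈ S, 0 ≤ u v) ∨ ∀ v ∈ S, u v ≤ 0

/-- `X` is a random vector: all its linear images are measurable. No topology on `V` is needed. -/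
def LinMeasurable {V Ω : Type*} [AddCommGroup V] [Module ℝ V] [MeasurableSpace Ω]
    (X : Ω → V) : Prop :=
  ∀ u : Module.Dual ℝ V, Measurable fun ω => u (X ω)

/-- A family `T` of at most `N` cells `(A, S)`: the event `A` has mass at least `c`, and on it the
random vector `X` takes values in the relative interior of the cone over `S`, which has at most `N`
generators. -/
structure IsCellFamily {V Ω : Type*} [AddCommGroup V] [Module ℝ V] [MeasurableSpace Ω]
    (μ : Measure Ω) (X : Ω → V) (N : ℕ) (c : ℝ) (T : Finset (Set Ω × Finset V)) : Prop where
  card_le : T.card ≤ N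
  gen_card_le : ∀ p ∈ T, p.2.card ≤ N
  meas : ∀ p ∈ T, MeasurableSet p.1
  mass_le : ∀ p ∈ T, c ≤ μ.real p.1
  mem : ∀ p ∈ T, ∀ ω ∈ p.1, X ω ∈ relintCone p.2

section Cells
variable {V W Ω : Type*} [AddCommGroup V] [Module ℝ V] [AddCommGroup W] [Module ℝ W]
  [MeasurableSpace Ω]

theorem relintCone_smul {S : Finset V} {x : V} {r : ℝ} (hr : 0 < r) (h : r • x ∈ relintCone S) :
    x ∈ relintCone S := by
  intro u hu
  obtain ⟨h1, h2⟩ := h u hu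
  rw [map_smul, smul_eq_mul] at h1 h2
  exact ⟨nonneg_of_mul_nonneg_right h1 hr, fun h0 => h2 (by rw [h0, mul_zero])⟩

open Classical in
theorem relintCone_image {S : Finset W} {x : W} (φ : W →ₗ[ℝ] V) (h : x ∈ relintCone S) :
    φ x ∈ relintCone (S.image φ) := by
  intro u hu
  simp only [Finset.mem_image, forall_exists_index, and_imp, forall_apply_eq_imp_iff₂] at hu ⊢
  exact h (u.comp φ) hu

open Classical in
theorem relintCone_insert {S : Finset V} {x v : V} {a : ℝ} (ha : 0 < a) (h : x ∈ relintCone S) :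
    x + a • v ∈ relintCone (insert v S) := by
  intro u hu
  simp only [Finset.forall_mem_insert] at hu ⊢
  obtain ⟨h1, h2⟩ := h u hu.2
  rw [map_add, map_smul, smul_eq_mul]
  have := mul_nonneg ha.le hu.1
  refine ⟨by linarith, fun h0 => ?_⟩
  have h3 : a * u v = 0 := by linarith
  exact ⟨(mul_eq_zero.1 h3).resolve_left ha.ne', h2 (by linarith)⟩

/-- A functional that is nonpositive on the generators and not identically zero there is negative
in the relative interior of the cone. -/
theorem neg_of_mem_relintCone {S : Finset V} {x : V} (h : x ∈ relintCone S)
    {u : Module.Dual ℝ V} (hu : ∀ v ∈ S, u v ≤ 0) (h0 : ¬ ∀ v ∈ S, 0 ≤ u v) : u x < 0 := by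
  obtain ⟨h1, h2⟩ := h (-u) fun v hv => by simpa using hu v hv
  simp only [LinearMap.neg_apply, neg_eq_zero, Left.nonneg_neg_iff] at h1 h2
  refine lt_of_le_of_ne h1 fun h3 => h0 fun v hv => (h2 h3 v hv).ge

theorem Avoids.neg {S : Finset V} {u : Module.Dual ℝ V} (h : Avoids (-u) S) : Avoids u S := by
  rcases h with h | h
  · exact Or.inr fun v hv => by simpa using h v hv
  · exact Or.inl fun v hv => by simpa using h v hv

open Classical in
/-- Cells for a random vector `X'` over the event `B` become cells for `X` when the generators are
transformed by `Φ` accordingly. -/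
theorem IsCellFamily.transfer {μ : Measure Ω} {B : Set Ω} (hB : MeasurableSet B)
    {X : Ω → V} {X' : Ω → W} {N N' : ℕ} {c : ℝ} {T : Finset (Set Ω × Finset W)}
    (h : IsCellFamily (μ.restrict B) X' N c T) (Φ : Finset W → Finset V) (hN : N ≤ N')
    (hcard : ∀ S, S.card ≤ N → (Φ S).card ≤ N')
    (hΦ : ∀ ω ∈ B, ∀ S, X' ω ∈ relintCone S → X ω ∈ relintCone (Φ S)) :
    IsCellFamily μ X N' c (T.image fun p => (p.1 ∩ B, Φ p.2)) where
  card_le := Finset.card_image_le.trans (h.card_le.trans hN)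
  gen_card_le := by
    simp only [Finset.forall_mem_image]
    exact fun p hp => hcard _ (h.gen_card_le p hp)
  meas := by
    simp only [Finset.forall_mem_image]
    exact fun p hp => (h.meas p hp).inter hB
  mass_le := by
    simp only [Finset.forall_mem_image]
    intro p hp
    have := h.mass_le p hp
    rwa [measureReal_restrict_apply (h.meas p hp)] at this
  mem := by
    simp only [Finset.forall_mem_image]
    exact fun p hp ω hω => hΦ ω hω.2 _ (h.mem p hp ω hω.1)

theorem IsCellFamily.mono {μ : Measure Ω} {X : Ω → V} {N N' : ℕ} {c c' : ℝ}
    {T : Finset (Set Ω × Finset V)} (h : IsCellFamily μ X N c T) (hN : N ≤ N') (hc : c' ≤ c) :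
    IsCellFamily μ X N' c' T where
  card_le := h.card_le.trans hN
  gen_card_le := fun p hp => (h.gen_card_le p hp).trans hN
  meas := h.meas
  mass_le := fun p hp => hc.trans (h.mass_le p hp)
  mem := h.mem

open Classical in
theorem IsCellFamily.union {μ : Measure Ω} {X : Ω → V} {N N' : ℕ} {c : ℝ}
    {T T' : Finset (Set Ω × Finset V)} (h : IsCellFamily μ X N c T)
    (h' : IsCellFamily μ X N' c T') : IsCellFamily μ X (N + N') c (T ∪ T') where
  card_le := (Finset.card_union_le _ _).trans (Nat.add_le_add h.card_le h'.card_le)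
  gen_card_le := fun p hp => by
    rcases Finset.mem_union.1 hp with hp | hp
    · exact (h.gen_card_le p hp).trans (Nat.le_add_right _ _)
    · exact (h'.gen_card_le p hp).trans (Nat.le_add_left _ _)
  meas := fun p hp => (Finset.mem_union.1 hp).elim (h.meas p) (h'.meas p)
  mass_le := fun p hp => (Finset.mem_union.1 hp).elim (h.mass_le p) (h'.mass_le p)
  mem := fun p hp => (Finset.mem_union.1 hp).elim (h.mem p) (h'.mem p)

open Classical in
theorem IsCellFamily.biUnion {ι : Type*} {μ : Measure Ω} {X : Ω → V} {M N : ℕ} {c : ℝ}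
    {I : Finset ι} (hI : I.card ≤ M) {T : ι → Finset (Set Ω × Finset V)}
    (h : ∀ i ∈ I, IsCellFamily μ X N c (T i)) :
    IsCellFamily μ X (M * N + N) c (I.biUnion T) where
  card_le := (Finset.card_biUnion_le_card_mul _ _ N fun i hi => (h i hi).card_le).trans
    ((Nat.mul_le_mul_right N hI).trans (Nat.le_add_right _ _))
  gen_card_le := fun p hp => by
    obtain ⟨i, hi, hp⟩ := Finset.mem_biUnion.1 hp
    exact ((h i hi).gen_card_le p hp).trans (Nat.le_add_left _ _)
  meas := fun p hp => by
    obtain ⟨i, hi, hp⟩ := Finset.mem_biUnion.1 hp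
    exact (h i hi).meas p hp
  mass_le := fun p hp => by
    obtain ⟨i, hi, hp⟩ := Finset.mem_biUnion.1 hp
    exact (h i hi).mass_le p hp
  mem := fun p hp => by
    obtain ⟨i, hi, hp⟩ := Finset.mem_biUnion.1 hp
    exact (h i hi).mem p hp

end Cells

/-- Weak Yao–Yao property in dimension at most `n`: every random vector admits at most `N` cells,
each with a fraction `c` of the mass, such that every hyperplane through the origin avoids one of
them. -/
def AvoidedCells (n N : ℕ) (c : ℝ) : Prop :=
  ∀ (V : Type) [AddCommGroup V] [Module ℝ V] [FiniteDimensional ℝ V], Module.finrank ℝ V ≤ n →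
  ∀ (Ω : Type) [MeasurableSpace Ω] (μ : Measure Ω) [IsFiniteMeasure μ] (X : Ω → V),
    LinMeasurable X →
    ∃ T, IsCellFamily μ X N (c * μ.real Set.univ) T ∧ ∀ u, ∃ p ∈ T, Avoids u p.2

/-- Every random vector in dimension at most `n` admits at most `N` cells, each with a fraction `c`
of the mass, such that every closed halfspace with the origin on its boundary and with at least a
`τ` fraction of the mass contains all generators of one of them. -/
def ContainedCells (n : ℕ) (τ : ℝ) (N : ℕ) (c : ℝ) : Prop :=
  ∀ (V : Type) [AddCommGroup V] [Module ℝ V] [FiniteDimensional ℝ V], Module.finrank ℝ V ≤ n →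
  ∀ (Ω : Type) [MeasurableSpace Ω] (μ : Measure Ω) [IsFiniteMeasure μ] (X : Ω → V),
    LinMeasurable X → 0 < μ.real Set.univ →
    ∃ T, IsCellFamily μ X N (c * μ.real Set.univ) T ∧
      ∀ u : Module.Dual ℝ V, τ * μ.real Set.univ ≤ μ.real {ω | 0 ≤ u (X ω)} →
        ∃ p ∈ T, ∀ v ∈ p.2, 0 ≤ u v

/-- If a halfspace contains none of the cells of an avoided family, it is disjoint from one of them;
removing that cell leaves the mass of the halfspace unchanged but shrinks the total mass by a fixed factor.
After boundedly many rounds the halfspace would be heavier than the whole space. -/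
theorem AvoidedCells.exists_containedCells {n N₀ : ℕ} {c : ℝ} (hc0 : 0 < c) (hc1 : c < 1)
    (h : AvoidedCells n N₀ c) {τ : ℝ} (hτ : 0 < τ) :
    ∃ (N : ℕ) (c' : ℝ), 0 < c' ∧ ContainedCells n τ N c' := by
  classical
  have key : ∀ r : ℕ, ∃ N : ℕ,
      ∀ (V : Type) [AddCommGroup V] [Module ℝ V] [FiniteDimensional ℝ V], Module.finrank ℝ V ≤ n →
      ∀ (Ω : Type) [MeasurableSpace Ω] (μ : Measure Ω) [IsFiniteMeasure μ] (X : Ω → V),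
        LinMeasurable X → ∀ M : ℝ, (1 - c) ^ r * μ.real Set.univ < M →
        ∃ T, IsCellFamily μ X N (c * M) T ∧
          ∀ u : Module.Dual ℝ V, M ≤ μ.real {ω | 0 ≤ u (X ω)} → ∃ p ∈ T, ∀ v ∈ p.2, 0 ≤ u v := by
    intro r
    induction r with
    | zero =>
      refine ⟨0, fun V _ _ _ _ Ω _ μ _ X _ M hM => ⟨∅, ⟨by simp, by simp, by simp, by simp,
        by simp⟩, fun u hu => ?_⟩⟩
      have := measureReal_mono (μ := μ) (Set.subset_univ {ω | 0 ≤ u (X ω)})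
      simp only [pow_zero, one_mul] at hM
      linarith
    | succ r ih =>
      obtain ⟨N₁, ih⟩ := ih
      refine ⟨N₀ + (N₀ * N₁ + N₁), fun V _ _ _ hV Ω _ μ _ X hX M hM => ?_⟩
      by_cases hlt : μ.real Set.univ < M
      · refine ⟨∅, ⟨by simp, by simp, by simp, by simp, by simp⟩, fun u hu => ?_⟩
        have := measureReal_mono (μ := μ) (Set.subset_univ {ω | 0 ≤ u (X ω)})
        linarith
      push Not at hlt
      obtain ⟨T₀, hT₀, hu₀⟩ := h V hV Ω μ X hX
      have hrest : ∀ p : Set Ω × Finset V, ∃ T, p ∈ T₀ →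
          IsCellFamily (μ.restrict p.1ᶜ) X N₁ (c * M) T ∧ ∀ u : Module.Dual ℝ V,
            M ≤ (μ.restrict p.1ᶜ).real {ω | 0 ≤ u (X ω)} → ∃ p ∈ T, ∀ v ∈ p.2, 0 ≤ u v := by
        intro p
        by_cases hp : p ∈ T₀
        · obtain ⟨T, hT⟩ := ih V hV Ω (μ.restrict p.1ᶜ) X hX M (by
            refine lt_of_le_of_lt ?_ hM
            rw [pow_succ, mul_assoc]
            refine mul_le_mul_of_nonneg_left ?_ (pow_nonneg (by linarith) _)
            rw [measureReal_restrict_apply MeasurableSet.univ, Set.univ_inter]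
            have h1 := measureReal_add_measureReal_compl (μ := μ) (hT₀.meas p hp)
            have h2 := hT₀.mass_le p hp
            linarith)
          exact ⟨T, fun _ => hT⟩
        · exact ⟨∅, fun h => absurd h hp⟩
      choose T hT using hrest
      refine ⟨T₀ ∪ T₀.biUnion fun p => (T p).image fun p' => (p'.1 ∩ p.1ᶜ, id p'.2), ?_, ?_⟩
      · refine (hT₀.mono le_rfl (mul_le_mul_of_nonneg_left hlt hc0.le)).union
          (IsCellFamily.biUnion hT₀.card_le fun p hp => ?_)
        exact (hT p hp).1.transfer (hT₀.meas p hp).compl id le_rfl (fun S hS => hS)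
          fun ω _ S hS => hS
      · intro u hu
        obtain ⟨p, hp, hav⟩ := hu₀ u
        by_cases hpos : ∀ v ∈ p.2, 0 ≤ u v
        · exact ⟨p, Finset.mem_union_left _ hp, hpos⟩
        have hneg := hav.resolve_left hpos
        obtain ⟨p', hp', hpu⟩ := (hT p hp).2 u (by
          rw [measureReal_restrict_apply (measurableSet_le measurable_const (hX u))]
          refine hu.trans (measureReal_mono fun ω (hω : 0 ≤ u (X ω)) => ⟨hω, fun hmem => ?_⟩)
          exact absurd hω (not_le.2 (neg_of_mem_relintCone (hT₀.mem p hp ω hmem) hneg hpos)))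
        exact ⟨(p'.1 ∩ p.1ᶜ, id p'.2), Finset.mem_union_right _ (Finset.mem_biUnion.2
          ⟨p, hp, Finset.mem_image_of_mem _ hp'⟩), hpu⟩
  obtain ⟨r, hr⟩ := exists_pow_lt_of_lt_one hτ (show 1 - c < 1 by linarith)
  obtain ⟨N, hN⟩ := key r
  refine ⟨N, c * τ, by positivity, fun V _ _ _ hV Ω _ μ _ X hX hμ => ?_⟩
  obtain ⟨T, hT, hu⟩ := hN V hV Ω μ X hX (τ * μ.real Set.univ) (mul_lt_mul_of_pos_right hr hμ)
  exact ⟨T, by rwa [mul_assoc], hu⟩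

/-! ### The weak Yao–Yao theorem -/

section Step
variable {V Ω : Type} [AddCommGroup V] [Module ℝ V] [FiniteDimensional ℝ V] [MeasurableSpace Ω]
  {μ : Measure Ω} [IsFiniteMeasure μ] {X : Ω → V}

/-- The part of the mass on a hyperplane is handled in one dimension less. -/
theorem AvoidedCells.of_ker {n N : ℕ} {c : ℝ} (h : AvoidedCells n N c) (hX : LinMeasurable X)
    (hV : Module.finrank ℝ V ≤ n + 1) {s : Module.Dual ℝ V} (hs : s ≠ 0) {B : Set Ω}
    (hB : MeasurableSet B) (hB0 : ∀ ω ∈ B, s (X ω) = 0) :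
    ∃ T, IsCellFamily μ X N (c * μ.real B) T ∧ ∀ u, ∃ p ∈ T, Avoids u p.2 := by
  classical
  have hfin : Module.finrank ℝ (LinearMap.ker s) ≤ n := by
    have : LinearMap.ker s < ⊤ := lt_top_iff_ne_top.2 fun h => hs (LinearMap.ker_eq_top.1 h)
    have := Submodule.finrank_lt this.ne
    omega
  obtain ⟨π, hπ⟩ := (LinearMap.ker s).subtype.exists_leftInverse_of_injective
    (LinearMap.ker s).ker_subtype
  obtain ⟨T, hT, hu⟩ := h (LinearMap.ker s) hfin Ω (μ.restrict B) (fun ω => π (X ω))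
    fun u => hX (u.comp π)
  rw [measureReal_restrict_apply MeasurableSet.univ, Set.univ_inter] at hT
  refine ⟨_, hT.transfer (X := X) hB (fun S => S.image (LinearMap.ker s).subtype) le_rfl
    (fun S hS => Finset.card_image_le.trans hS) fun ω hω S hS => ?_, fun u => ?_⟩
  · have h1 := relintCone_image (LinearMap.ker s).subtype hS
    have h2 : π (X ω) = ⟨X ω, hB0 ω hω⟩ := LinearMap.congr_fun hπ ⟨X ω, hB0 ω hω⟩
    rwa [h2] at h1
  · obtain ⟨p, hp, hav⟩ := hu (u.comp (LinearMap.ker s).subtype)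
    refine ⟨_, Finset.mem_image_of_mem _ hp, ?_⟩
    simpa [Avoids] using hav

/-- The cells on one side `g > 0` of a dividing hyperplane. The vectors `c` on the hyperplane and
`e` on the side `g > 0` span a plane, and modulo this plane the origin is deep in the part `B` of
the mass on this side. Cells that catch the deep halfspaces of the quotient, together with the
generators `c` and `e`, catch all halfspaces that contain `c` and `e`. -/
theorem ContainedCells.of_side {n N : ℕ} {τ κ : ℝ} (h : ContainedCells n τ N κ)
    (hX : LinMeasurable X) (hV : Module.finrank ℝ V ≤ n + 1) {s g : Module.Dual ℝ V}
    (hs : ∀ ω, s (X ω) = 1) {c e : V} (hsc : s c = 1) (hse : s e = 0) (hgc : g c = 0)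
    (hge : 0 < g e) {B : Set Ω} (hB : MeasurableSet B) (hBg : ∀ ω ∈ B, 0 < g (X ω))
    (hB0 : 0 < μ.real B)
    (hdepth : ∀ u : Module.Dual ℝ V, u c = 0 → u e = 0 →
      τ * μ.real B ≤ μ.real ({ω | 0 ≤ u (X ω)} ∩ B)) :
    ∃ T, IsCellFamily μ X (N + 2) (κ * μ.real B) T ∧
      ∀ u : Module.Dual ℝ V, 0 ≤ u c → 0 ≤ u e → ∃ p ∈ T, ∀ v ∈ p.2, 0 ≤ u v := by
  classical
  set U : Submodule ℝ V := LinearMap.ker s ⊓ LinearMap.ker g with hU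
  have hfin : Module.finrank ℝ U ≤ n := by
    have : U < ⊤ := lt_top_iff_ne_top.2 fun h => by
      have : c ∈ U := by rw [h]; trivial
      have := (Submodule.mem_inf.1 this).1
      rw [LinearMap.mem_ker, hsc] at this
      exact one_ne_zero this
    have := Submodule.finrank_lt this.ne
    omega
  let π₀ : V →ₗ[ℝ] V := LinearMap.id - (g.smulRight ((g e)⁻¹ • e)) - s.smulRight c
  have hπ₀ : ∀ x, π₀ x = x - (g x * (g e)⁻¹) • e - s x • c := fun x => by
    simp [π₀, smul_smul]
  let π : V →ₗ[ℝ] U := π₀.codRestrict U fun x => by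
    rw [hU, Submodule.mem_inf, LinearMap.mem_ker, LinearMap.mem_ker, hπ₀]
    simp [hse, hsc, hgc, hge.ne']
  have hπ : ∀ x, (π x : V) = x - (g x * (g e)⁻¹) • e - s x • c := hπ₀
  obtain ⟨T, hT, hu⟩ := h U hfin Ω (μ.restrict B) (fun ω => π (X ω)) (fun u => hX (u.comp π))
    (by rwa [measureReal_restrict_apply MeasurableSet.univ, Set.univ_inter])
  rw [measureReal_restrict_apply MeasurableSet.univ, Set.univ_inter] at hT hu
  refine ⟨_, hT.transfer (X := X) hB (fun S => insert e (insert c (S.image U.subtype)))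
    (N' := N + 2) (by omega) (fun S hS => ?_) (fun ω hω S hS => ?_), fun u huc hue => ?_⟩
  · refine (Finset.card_insert_le _ _).trans (Nat.succ_le_succ ?_)
    exact (Finset.card_insert_le _ _).trans (Nat.succ_le_succ (Finset.card_image_le.trans hS))
  · have h1 := relintCone_insert (v := e) (mul_pos (hBg ω hω) (inv_pos.2 hge))
      (relintCone_insert (v := c) one_pos (relintCone_image U.subtype hS))
    have h2 : U.subtype (π (X ω)) + (1 : ℝ) • c + (g (X ω) * (g e)⁻¹) • e = X ω := by
      rw [Submodule.subtype_apply, hπ, hs]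
      abel
    rwa [h2] at h1
  · have hπc : (π c : V) = 0 := by rw [hπ, hgc, hsc]; simp
    have hπe : (π e : V) = 0 := by rw [hπ, hse, mul_inv_cancel₀ hge.ne']; simp
    obtain ⟨p, hp, hpos⟩ := hu (u.comp U.subtype) (by
      have hm : MeasurableSet {ω | 0 ≤ (u.comp U.subtype) (π (X ω))} :=
        measurableSet_le measurable_const (hX ((u.comp U.subtype).comp π))
      rw [measureReal_restrict_apply hm]
      exact hdepth ((u.comp U.subtype).comp π) (by simp [hπc]) (by simp [hπe]))
    refine ⟨_, Finset.mem_image_of_mem _ hp, ?_⟩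
    simpa [huc, hue] using hpos

theorem measureReal_pos_add_neg_add_zero {f : Ω → ℝ} (hf : Measurable f) :
    μ.real {ω | 0 < f ω} + μ.real {ω | f ω < 0} + μ.real {ω | f ω = 0} = μ.real Set.univ := by
  have h1 := measureReal_add_measureReal_compl (μ := μ)
    (measurableSet_lt measurable_const hf : MeasurableSet {ω | 0 < f ω})
  have h2 := measureReal_union (μ := μ) (s₁ := {ω | f ω < 0}) (s₂ := {ω | f ω = 0})
    (Set.disjoint_left.2 fun ω (h : f ω < 0) h' => h.ne h')
    (measurableSet_eq_fun hf measurable_const)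
  have h3 : {ω | 0 < f ω}ᶜ = {ω | f ω < 0} ∪ {ω | f ω = 0} := by
    ext ω
    simp [le_iff_lt_or_eq]
  rw [h3, h2] at h1
  linarith

/-- The inductive step on an affine slice `s = 1`. A median hyperplane `g = 0` either carries a
third of the mass, or the masses on its two sides have centerpoints `c₁` and `c₂`. Projecting along
`c₁ - c₂` makes the two centerpoints coincide, so that any hyperplane has, after the projection,
a deep halfspace on the appropriate side. -/
theorem AvoidedCells.of_normalized {n N N' : ℕ} {c κ : ℝ} (h : AvoidedCells n N c)
    (hc0 : 0 < c) (hc1 : c < 1) (hκ0 : 0 < κ) (hK : ContainedCells n (1 / (2 * ((n : ℝ) + 2))) N' κ)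
    (hX : LinMeasurable X) (hV : Module.finrank ℝ V ≤ n + 1) {s : Module.Dual ℝ V}
    (hs : ∀ ω, s (X ω) = 1) :
    ∃ T, IsCellFamily μ X (N + ((N' + 2) + (N' + 2)) + 1) (min (c / 3) (κ / 6) * μ.real Set.univ) T
      ∧ ∀ u, ∃ p ∈ T, Avoids u p.2 := by
  classical
  set M := μ.real Set.univ with hM
  rcases eq_or_lt_of_le (measureReal_nonneg (μ := μ) (s := Set.univ)) with h0 | hpos
  · refine ⟨{(∅, ∅)}, ⟨by simp, by simp, by simp, ?_, by simp⟩, fun u => ⟨_,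
      Finset.mem_singleton_self _, Or.inl (by simp)⟩⟩
    simp [hM, ← h0]
  rw [← hM] at hpos
  obtain ⟨ω₀, -⟩ : (Set.univ : Set Ω).Nonempty := by
    refine Set.nonempty_iff_ne_empty.2 fun h0 => ?_
    rw [hM, h0, measureReal_empty] at hpos
    exact lt_irrefl _ hpos
  have hs0 : s ≠ 0 := fun h0 => by simpa [h0] using hs ω₀
  have hcl : min (c / 3) (κ / 6) * M ≤ c / 3 * M :=
    mul_le_mul_of_nonneg_right (min_le_left _ _) hpos.le
  have hκl : min (c / 3) (κ / 6) * M ≤ κ / 6 * M :=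
    mul_le_mul_of_nonneg_right (min_le_right _ _) hpos.le
  by_cases hker : LinearMap.ker s = ⊥
  · refine ⟨{(Set.univ, {X ω₀})}, ⟨by simp, by simp, by simp, ?_, ?_⟩, fun u => ⟨_,
      Finset.mem_singleton_self _, ?_⟩⟩
    · simp only [Finset.mem_singleton, forall_eq]
      nlinarith
    · simp only [Finset.mem_singleton, forall_eq]
      intro ω _ u hu
      have : X ω = X ω₀ := LinearMap.ker_eq_bot.1 hker (by rw [hs, hs])
      simpa [this] using hu
    · simpa [Avoids] using le_total _ _
  obtain ⟨v, hv, hv0⟩ := Submodule.exists_mem_ne_zero_of_ne_bot hker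
  rw [LinearMap.mem_ker] at hv
  obtain ⟨g₀, hg₀⟩ : ∃ g₀ : Module.Dual ℝ V, g₀ v ≠ 0 := by
    by_contra! h0
    exact hv0 ((Module.forall_dual_apply_eq_zero_iff ℝ v).1 h0)
  obtain ⟨b, hb1, hb2⟩ := exists_median μ (hX g₀)
  set g : Module.Dual ℝ V := g₀ - b • s with hg
  have hgX : ∀ ω, g (X ω) = g₀ (X ω) - b := fun ω => by simp [hg, hs]
  have hg0 : g ≠ 0 := fun h0 => hg₀ (by simpa [hg, hv] using LinearMap.congr_fun h0 v)
  have hneg : μ.real {ω | g (X ω) < 0} ≤ M / 2 := by simpa [hgX] using hb1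
  have hposm : μ.real {ω | 0 < g (X ω)} ≤ M / 2 := by simpa [hgX] using hb2
  have hsum := measureReal_pos_add_neg_add_zero (μ := μ) (hX g)
  by_cases hzero : M / 3 ≤ μ.real {ω | g (X ω) = 0}
  · obtain ⟨T, hT, hu⟩ := h.of_ker (μ := μ) hX hV hg0 (B := {ω | g (X ω) = 0})
      (measurableSet_eq_fun (hX g) measurable_const) fun ω hω => hω
    exact ⟨T, hT.mono (by omega) (hcl.trans (by nlinarith)), hu⟩
  push Not at hzero
  have hτ : (1 : ℝ) / (2 * ((n : ℝ) + 2)) ≤ 1 / (2 * ((Module.finrank ℝ V : ℝ) + 1)) := by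
    have : (Module.finrank ℝ V : ℝ) ≤ n + 1 := by exact_mod_cast hV
    apply one_div_le_one_div_of_le (by positivity)
    linarith
  -- a centerpoint of the mass strictly on one side of a hyperplane lies strictly on that side
  have hcenter : ∀ f : Module.Dual ℝ V, 0 < μ.real {ω | 0 < f (X ω)} →
      ∃ c₁, s c₁ = 1 ∧ 0 < f c₁ ∧ ∀ u : Module.Dual ℝ V, 0 ≤ u c₁ →
        1 / (2 * ((n : ℝ) + 2)) * μ.real {ω | 0 < f (X ω)} ≤
          μ.real ({ω | 0 ≤ u (X ω)} ∩ {ω | 0 < f (X ω)}) := by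
    intro f hf
    obtain ⟨c₁, hs1, hc⟩ := exists_centerpoint (μ.restrict {ω | 0 < f (X ω)})
      (by rwa [measureReal_restrict_apply MeasurableSet.univ, Set.univ_inter]) hX s hs
    have hc' : ∀ u : Module.Dual ℝ V, 0 ≤ u c₁ →
        1 / (2 * ((n : ℝ) + 2)) * μ.real {ω | 0 < f (X ω)} ≤
          μ.real ({ω | 0 ≤ u (X ω)} ∩ {ω | 0 < f (X ω)}) := by
      intro u hu
      have := hc u hu
      rw [measureReal_restrict_apply MeasurableSet.univ, Set.univ_inter,
        measureReal_restrict_apply (measurableSet_le measurable_const (hX u))] at this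
      exact (mul_le_mul_of_nonneg_right hτ hf.le).trans this
    refine ⟨c₁, hs1, ?_, hc'⟩
    by_contra! hle
    have h1 := hc' (-f) (by simpa using hle)
    have h2 : {ω | 0 ≤ (-f) (X ω)} ∩ {ω | 0 < f (X ω)} = ∅ := by
      ext ω
      simp
    rw [h2, measureReal_empty] at h1
    have : 0 < 1 / (2 * ((n : ℝ) + 2)) * μ.real {ω | 0 < f (X ω)} := by positivity
    linarith
  have hnegset : {ω | 0 < (-g) (X ω)} = {ω | g (X ω) < 0} := by ext; simp
  have hB₁ : M / 6 ≤ μ.real {ω | 0 < g (X ω)} := by linarith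
  have hB₂ : M / 6 ≤ μ.real {ω | 0 < (-g) (X ω)} := by rw [hnegset]; linarith
  obtain ⟨c₁, hsc₁, hgc₁, hc₁⟩ := hcenter g (by linarith)
  obtain ⟨c₂, hsc₂, hgc₂, hc₂⟩ := hcenter (-g) (by linarith)
  rw [LinearMap.neg_apply] at hgc₂
  set e := c₁ - c₂ with he
  have hge : 0 < g e := by rw [he, map_sub]; linarith
  set p := c₁ - (g c₁ * (g e)⁻¹) • e with hp
  have hse : s e = 0 := by rw [he, map_sub, hsc₁, hsc₂, sub_self]
  have hsp : s p = 1 := by rw [hp, map_sub, map_smul, hse, hsc₁]; simp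
  have hgp : g p = 0 := by rw [hp, map_sub, map_smul, smul_eq_mul]; field_simp; ring
  have huc₁ : ∀ u : Module.Dual ℝ V, u p = 0 → u e = 0 → u c₁ = 0 := by
    intro u h1 h2
    rw [hp, map_sub, map_smul, h2, smul_zero, sub_zero] at h1
    exact h1
  have huc₂ : ∀ u : Module.Dual ℝ V, u p = 0 → u e = 0 → u c₂ = 0 := by
    intro u h1 h2
    have h3 := huc₁ u h1 h2
    rw [he, map_sub, h3] at h2
    linarith
  obtain ⟨T₁, hT₁, hu₁⟩ := hK.of_side (μ := μ) hX hV hs hsp hse hgp hge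
    (measurableSet_lt measurable_const (hX g)) (fun ω hω => hω) (by linarith)
    fun u h1 h2 => hc₁ u (huc₁ u h1 h2).ge
  obtain ⟨T₂, hT₂, hu₂⟩ := hK.of_side (μ := μ) (g := -g) (e := -e) hX hV hs hsp (by simp [hse])
    (by simp [hgp]) (by simpa using hge)
    (measurableSet_lt measurable_const (hX (-g))) (fun ω hω => hω) (by linarith)
    fun u h1 h2 => hc₂ u (huc₂ u h1 (by simpa using h2)).ge
  refine ⟨T₁ ∪ T₂, ((hT₁.mono le_rfl ?_).union (hT₂.mono le_rfl ?_)).mono (by omega) hκl, ?_⟩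
  · calc κ / 6 * M = κ * (M / 6) := by ring
      _ ≤ _ := mul_le_mul_of_nonneg_left hB₁ hκ0.le
  · calc κ / 6 * M = κ * (M / 6) := by ring
      _ ≤ _ := mul_le_mul_of_nonneg_left hB₂ hκ0.le
  -- after a change of sign `u p` is nonnegative; the sign of `u e` then selects the side
  have hmain : ∀ u : Module.Dual ℝ V, 0 ≤ u p → ∃ q ∈ T₁ ∪ T₂, ∀ v ∈ q.2, 0 ≤ u v := by
    intro u hup
    rcases le_total 0 (u e) with hue | hue
    · obtain ⟨q, hq, h1⟩ := hu₁ u hup hue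
      exact ⟨q, Finset.mem_union_left _ hq, h1⟩
    · obtain ⟨q, hq, h1⟩ := hu₂ u hup (by simpa using hue)
      exact ⟨q, Finset.mem_union_right _ hq, h1⟩
  intro u
  rcases le_total 0 (u p) with hup | hup
  · obtain ⟨q, hq, h1⟩ := hmain u hup
    exact ⟨q, hq, Or.inl h1⟩
  · obtain ⟨q, hq, h1⟩ := hmain (-u) (by simpa using hup)
    exact ⟨q, hq, Avoids.neg (Or.inl h1)⟩

/-- The inductive step on a halfspace `s > 0`, by central projection to the slice `s = 1`. -/
theorem AvoidedCells.of_pos {n N N' : ℕ} {c κ : ℝ} (h : AvoidedCells n N c)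
    (hc0 : 0 < c) (hc1 : c < 1) (hκ0 : 0 < κ) (hK : ContainedCells n (1 / (2 * ((n : ℝ) + 2))) N' κ)
    (hX : LinMeasurable X) (hV : Module.finrank ℝ V ≤ n + 1) {s : Module.Dual ℝ V} (hs : s ≠ 0) :
    ∃ T, IsCellFamily μ X (N + ((N' + 2) + (N' + 2)) + 1)
        (min (c / 3) (κ / 6) * μ.real {ω | 0 < s (X ω)}) T ∧ ∀ u, ∃ p ∈ T, Avoids u p.2 := by
  classical
  set B : Set Ω := {ω | 0 < s (X ω)} with hBdef
  have hB : MeasurableSet B := measurableSet_lt measurable_const (hX s)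
  obtain ⟨v, hv⟩ : ∃ v, s v = 1 := by
    obtain ⟨w, hw⟩ := DFunLike.ne_iff.1 hs
    exact ⟨(s w)⁻¹ • w, by simpa using inv_mul_cancel₀ hw⟩
  let X' : Ω → V := fun ω => if ω ∈ B then (s (X ω))⁻¹ • X ω else v
  have hX' : LinMeasurable X' := fun u => by
    have : (fun ω => u (X' ω)) = fun ω => if ω ∈ B then (s (X ω))⁻¹ * u (X ω) else u v := by
      ext ω
      by_cases hω : ω ∈ B <;> simp [X', hω]
    rw [this]
    exact Measurable.ite hB ((hX s).inv.mul (hX u)) measurable_const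
  have hs' : ∀ ω, s (X' ω) = 1 := fun ω => by
    by_cases hω : ω ∈ B
    · have : s (X ω) ≠ 0 := (show 0 < s (X ω) from hω).ne'
      simp [X', hω, this]
    · simp [X', hω, hv]
  obtain ⟨T, hT, hu⟩ := h.of_normalized (μ := μ.restrict B) hc0 hc1 hκ0 hK hX' hV hs'
  rw [measureReal_restrict_apply MeasurableSet.univ, Set.univ_inter] at hT
  refine ⟨_, hT.transfer (X := X) hB id le_rfl (fun S hS => hS) fun ω hω S hS => ?_, fun u => ?_⟩
  · have h1 : X' ω = (s (X ω))⁻¹ • X ω := by simp [X', hω]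
    rw [h1] at hS
    exact relintCone_smul (inv_pos.2 hω) hS
  · obtain ⟨p, hp, hav⟩ := hu u
    exact ⟨_, Finset.mem_image_of_mem _ hp, hav⟩

end Step

/-- **Weak Yao–Yao theorem.** One of the events `s > 0`, `s < 0`, `s = 0`, for any nonzero
functional `s`, carries a third of the mass. -/
theorem exists_avoidedCells (n : ℕ) :
    ∃ (N : ℕ) (c : ℝ), 0 < c ∧ c < 1 ∧ AvoidedCells n N c := by
  classical
  -- in dimension zero the whole space is one cell
  have htriv : ∀ (V : Type) [AddCommGroup V] [Module ℝ V] [FiniteDimensional ℝ V],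
      Module.finrank ℝ V = 0 → ∀ (Ω : Type) [MeasurableSpace Ω] (μ : Measure Ω) [IsFiniteMeasure μ]
      (X : Ω → V), ∃ T, IsCellFamily μ X 1 (μ.real Set.univ) T ∧
        ∀ u, ∃ p ∈ T, Avoids u p.2 := by
    intro V _ _ _ hV Ω _ μ _ X
    have := Module.finrank_zero_iff.1 hV
    refine ⟨{(Set.univ, ∅)}, ⟨by simp, by simp, by simp, by simp, ?_⟩, fun u => ⟨_,
      Finset.mem_singleton_self _, Or.inl (by simp)⟩⟩
    simp only [Finset.mem_singleton, forall_eq]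
    intro ω _ u _
    simp [Subsingleton.elim (X ω) 0]
  induction n with
  | zero =>
    refine ⟨1, 1 / 2, by norm_num, by norm_num, fun V _ _ _ hV Ω _ μ _ X _ => ?_⟩
    obtain ⟨T, hT, hu⟩ := htriv V (Nat.le_zero.1 hV) Ω μ X
    have := measureReal_nonneg (μ := μ) (s := Set.univ)
    exact ⟨T, hT.mono le_rfl (by linarith), hu⟩
  | succ n ih =>
    obtain ⟨N, c, hc0, hc1, h⟩ := ih
    obtain ⟨N', κ, hκ0, hK⟩ := h.exists_containedCells hc0 hc1
      (show (0 : ℝ) < 1 / (2 * ((n : ℝ) + 2)) by positivity)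
    set a := min (c / 3) (κ / 6) with ha
    have ha0 : 0 < a := by positivity
    have hac : a ≤ c / 3 := min_le_left _ _
    refine ⟨N + ((N' + 2) + (N' + 2)) + 1, a / 3, by positivity, by linarith,
      fun V _ _ _ hV Ω _ μ _ X hX => ?_⟩
    set M := μ.real Set.univ with hM
    have hM0 : 0 ≤ M := measureReal_nonneg
    by_cases hV0 : Module.finrank ℝ V = 0
    · obtain ⟨T, hT, hu⟩ := htriv V hV0 Ω μ X
      exact ⟨T, hT.mono (by omega) (by nlinarith), hu⟩
    obtain ⟨s, hs⟩ : ∃ s : Module.Dual ℝ V, s ≠ 0 := by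
      have : Nontrivial V := Module.finrank_pos_iff.1 (Nat.pos_of_ne_zero hV0)
      exact exists_ne 0
    have hsum := measureReal_pos_add_neg_add_zero (μ := μ) (hX s)
    have hns : {ω | 0 < (-s) (X ω)} = {ω | s (X ω) < 0} := by ext; simp
    obtain ⟨T₁, hT₁, hu₁⟩ := h.of_pos (μ := μ) hc0 hc1 hκ0 hK hX hV hs
    obtain ⟨T₂, hT₂, hu₂⟩ := h.of_pos (μ := μ) hc0 hc1 hκ0 hK hX hV (neg_ne_zero.2 hs)
    obtain ⟨T₃, hT₃, hu₃⟩ := h.of_ker (μ := μ) hX hV hs (B := {ω | s (X ω) = 0})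
      (measurableSet_eq_fun (hX s) measurable_const) fun ω hω => hω
    rw [hns] at hT₂
    by_cases h1 : M / 3 ≤ μ.real {ω | 0 < s (X ω)}
    · exact ⟨T₁, hT₁.mono le_rfl (by rw [← ha]; nlinarith), hu₁⟩
    by_cases h2 : M / 3 ≤ μ.real {ω | s (X ω) < 0}
    · exact ⟨T₂, hT₂.mono le_rfl (by rw [← ha]; nlinarith), hu₂⟩
    refine ⟨T₃, hT₃.mono (by omega) ?_, hu₃⟩
    have h3 : M / 3 ≤ μ.real {ω | s (X ω) = 0} := by linarith
    nlinarith

/-! ### Sign-homogeneous subsets -/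

theorem sign_eq_of_mem_relintCone {V : Type*} [AddCommGroup V] [Module ℝ V] {S : Finset V}
    {x x' : V} (hx : x ∈ relintCone S) (hx' : x' ∈ relintCone S) {u u' : Module.Dual ℝ V}
    (hu : Avoids u S) (h : ∀ v ∈ S, SignType.sign (u v) = SignType.sign (u' v)) :
    SignType.sign (u x) = SignType.sign (u' x') := by
  have hpos : ∀ {w w' : Module.Dual ℝ V}, (∀ v ∈ S, 0 ≤ w v) →
      (∀ v ∈ S, SignType.sign (w v) = SignType.sign (w' v)) →
      SignType.sign (w x) = SignType.sign (w' x') := by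
    intro w w' hw hww
    have hw' : ∀ v ∈ S, 0 ≤ w' v := fun v hv => by
      have := sign_nonneg_iff.2 (hw v hv)
      rw [hww v hv] at this
      exact sign_nonneg_iff.1 this
    obtain ⟨h1, h2⟩ := hx w hw
    obtain ⟨h1', h2'⟩ := hx' w' hw'
    by_cases h0 : ∀ v ∈ S, w v = 0
    · have h0' : ∀ v ∈ S, w' v = 0 := fun v hv => by
        have := hww v hv
        rw [h0 v hv, sign_zero] at this
        exact sign_eq_zero_iff.1 this.symm
      have h3 := (hx (-w) fun v hv => by simp [h0 v hv]).1
      have h3' := (hx' (-w') fun v hv => by simp [h0' v hv]).1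
      simp only [LinearMap.neg_apply, Left.nonneg_neg_iff] at h3 h3'
      rw [le_antisymm h3 h1, le_antisymm h3' h1']
    · have h3 : 0 < w x := lt_of_le_of_ne h1 fun h4 => h0 (h2 h4.symm)
      have h3' : 0 < w' x' := lt_of_le_of_ne h1' fun h4 => h0 fun v hv => by
        have := hww v hv
        rw [h2' h4.symm v hv, sign_zero] at this
        exact sign_eq_zero_iff.1 this
      rw [sign_pos h3, sign_pos h3']
  rcases hu with hu | hu
  · exact hpos hu h
  · have := hpos (w := -u) (w' := -u') (fun v hv => by simpa using hu v hv)
      (fun v hv => by simp only [LinearMap.neg_apply, Left.sign_neg, h v hv])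
    simp only [LinearMap.neg_apply, Left.sign_neg] at this
    exact neg_injective this

/-- The sign of `u` on the values of `X` over `A` is constant, and determined by the signs of `u` on
the points of `S`. -/
def Decided {V Ω : Type*} [AddCommGroup V] [Module ℝ V] (X : Ω → V) (A : Set Ω) (S : Finset V)
    (u : Module.Dual ℝ V) : Prop :=
  ∃ S' ⊆ S, (∀ ω ∈ A, X ω ∈ relintCone S') ∧ Avoids u S'

theorem Decided.sign_eq {V Ω : Type*} [AddCommGroup V] [Module ℝ V] {X : Ω → V} {A : Set Ω}
    {S : Finset V} {u u' : Module.Dual ℝ V} (h : Decided X A S u)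
    (hS : ∀ v ∈ S, SignType.sign (u v) = SignType.sign (u' v)) {ω ω' : Ω} (hω : ω ∈ A)
    (hω' : ω' ∈ A) : SignType.sign (u (X ω)) = SignType.sign (u' (X ω')) := by
  obtain ⟨S', hS', hA, hu⟩ := h
  exact sign_eq_of_mem_relintCone (hA ω hω) (hA ω' hω') hu fun v hv => hS v (hS' hv)

/-- Among boundedly many events of a fixed fraction of the mass there is one that decides any `M`
given functionals simultaneously. -/
theorem exists_decided_cells (n M : ℕ) : ∃ (N : ℕ) (c : ℝ), 0 < c ∧
    ∀ (V : Type) [AddCommGroup V] [Module ℝ V] [FiniteDimensional ℝ V], Module.finrank ℝ V ≤ n →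
    ∀ (Ω : Type) [MeasurableSpace Ω] (μ : Measure Ω) [IsFiniteMeasure μ] (X : Ω → V),
      LinMeasurable X → ∃ T : Finset (Set Ω × Finset V), T.card ≤ N ∧
        (∀ p ∈ T, p.2.card ≤ N ∧ MeasurableSet p.1 ∧ c * μ.real Set.univ ≤ μ.real p.1) ∧
        ∀ U : Finset (Module.Dual ℝ V), U.card ≤ M → ∃ p ∈ T, ∀ u ∈ U, Decided X p.1 p.2 u := by
  classical
  obtain ⟨N₀, c₀, hc₀, -, h₀⟩ := exists_avoidedCells n
  induction M with
  | zero =>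
    refine ⟨1, 1, one_pos, fun V _ _ _ _ Ω _ μ _ X _ => ⟨{(Set.univ, ∅)}, by simp, by simp,
      fun U hU => ⟨_, Finset.mem_singleton_self _, fun u hu => ?_⟩⟩⟩
    rw [Finset.card_eq_zero.1 (Nat.le_zero.1 hU)] at hu
    simp at hu
  | succ M ih =>
    obtain ⟨N, c, hc, ih⟩ := ih
    refine ⟨N * N₀ + (N₀ + N), c₀ * c, by positivity, fun V _ _ _ hV Ω _ μ _ X hX => ?_⟩
    obtain ⟨T, hT, hTp, hTu⟩ := ih V hV Ω μ X hX
    choose R hR hRu using fun p : Set Ω × Finset V => h₀ V hV Ω (μ.restrict p.1) X hX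
    refine ⟨T.biUnion fun p => (R p).image fun q => (q.1 ∩ p.1, q.2 ∪ p.2), ?_, ?_, ?_⟩
    · refine (Finset.card_biUnion_le_card_mul _ _ N₀ fun p _ =>
        Finset.card_image_le.trans (hR p).card_le).trans ?_
      exact (Nat.mul_le_mul_right N₀ hT).trans (Nat.le_add_right _ _)
    · simp only [Finset.mem_biUnion, Finset.mem_image]
      rintro _ ⟨p, hp, q, hq, rfl⟩
      obtain ⟨h1, h2, h3⟩ := hTp p hp
      refine ⟨?_, ((hR p).meas q hq).inter h2, ?_⟩
      · refine (Finset.card_union_le _ _).trans ?_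
        have := (hR p).gen_card_le q hq
        omega
      · have := (hR p).mass_le q hq
        rw [measureReal_restrict_apply MeasurableSet.univ, Set.univ_inter,
          measureReal_restrict_apply ((hR p).meas q hq)] at this
        calc c₀ * c * μ.real Set.univ = c₀ * (c * μ.real Set.univ) := by ring
          _ ≤ c₀ * μ.real p.1 := mul_le_mul_of_nonneg_left h3 hc₀.le
          _ ≤ _ := this
    · intro U hU
      obtain ⟨u, U', hUU, hU'⟩ : ∃ (u : Module.Dual ℝ V) (U' : Finset (Module.Dual ℝ V)),
          U ⊆ insert u U' ∧ U'.card ≤ M := by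
        rcases U.eq_empty_or_nonempty with rfl | ⟨u, hu⟩
        · exact ⟨0, ∅, by simp, by simp⟩
        · refine ⟨u, U.erase u, by rw [Finset.insert_erase hu], ?_⟩
          rw [Finset.card_erase_of_mem hu]
          omega
      obtain ⟨p, hp, hpU⟩ := hTu U' hU'
      obtain ⟨q, hq, hqu⟩ := hRu p u
      refine ⟨_, Finset.mem_biUnion.2 ⟨p, hp, Finset.mem_image_of_mem _ hq⟩, fun w hw => ?_⟩
      rcases Finset.mem_insert.1 (hUU hw) with rfl | hw'
      · exact ⟨q.2, Finset.subset_union_left, fun ω hω => (hR p).mem q hq ω hω.1, hqu⟩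
      · obtain ⟨S', hS', hA, hav⟩ := hpU w hw'
        exact ⟨S', hS'.trans Finset.subset_union_right, fun ω hω => hA ω hω.2, hav⟩

/-- In each of its variables, `f` is linear or does not depend on it. -/
def SeparatelyLinear {V : Type*} [AddCommGroup V] [Module ℝ V] {k : ℕ}
    (f : (Fin k → V) → ℝ) : Prop :=
  ∀ i, (∀ x, ∃ u : Module.Dual ℝ V, ∀ v, f (Function.update x i v) = u v) ∨
    ∀ x v w, f (Function.update x i v) = f (Function.update x i w)

theorem SeparatelyLinear.cons {V : Type*} [AddCommGroup V] [Module ℝ V] {k : ℕ}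
    {f : (Fin (k + 1) → V) → ℝ} (hf : SeparatelyLinear f) (v : V) :
    SeparatelyLinear fun y : Fin k → V => f (Fin.cons v y : Fin (k + 1) → V) := by
  intro i
  refine (hf i.succ).imp (fun h y => ?_) fun h y w w' => ?_
  · obtain ⟨u, hu⟩ := h (Fin.cons v y : Fin (k + 1) → V)
    exact ⟨u, fun w => by rw [← hu w, ← Fin.cons_update]⟩
  · have := h (Fin.cons v y : Fin (k + 1) → V) w w'
    simpa only [Fin.cons_update] using this

/-- **Same-type lemma.** Given `k` mass distributions and boundedly many separately linear functions
of `k` vectors, one can pass to a fixed fraction of each mass distribution so that the functions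
have constant signs on all transversals. The first variable is eliminated by substituting for it the
finitely many generators of a family of cells; the signs at the generators select a cell on which
the signs are decided. -/
theorem exists_constant_signs (n k : ℕ) : ∀ M : ℕ, ∃ c : ℝ, 0 < c ∧
    ∀ (V : Type) [AddCommGroup V] [Module ℝ V] [FiniteDimensional ℝ V], Module.finrank ℝ V ≤ n →
    ∀ (Ω : Type) [MeasurableSpace Ω] (μ : Fin k → Measure Ω) [∀ i, IsFiniteMeasure (μ i)]
      (X : Ω → V), LinMeasurable X → (∀ i, 0 < (μ i).real Set.univ) →
    ∀ F : Finset ((Fin k → V) → ℝ), F.card ≤ M → (∀ f ∈ F, SeparatelyLinear f) →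
      ∃ Y : Fin k → Set Ω, (∀ i, MeasurableSet (Y i)) ∧
        (∀ i, c * (μ i).real Set.univ ≤ (μ i).real (Y i)) ∧
        ∀ f ∈ F, ∀ ω ω' : Fin k → Ω, (∀ i, ω i ∈ Y i) → (∀ i, ω' i ∈ Y i) →
          SignType.sign (f fun i => X (ω i)) = SignType.sign (f fun i => X (ω' i)) := by
  classical
  induction k with
  | zero =>
    refine fun M => ⟨1, one_pos, fun V _ _ _ _ Ω _ μ _ X _ _ F _ _ => ⟨fun _ => Set.univ,
      fun i => i.elim0, fun i => i.elim0, fun f _ ω ω' _ _ => ?_⟩⟩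
    rw [Subsingleton.elim ω ω']
  | succ k ih =>
    intro M
    obtain ⟨N, c₀, hc₀, h₀⟩ := exists_decided_cells n M
    obtain ⟨c₁, hc₁, h₁⟩ := ih (M * (N * N + 1))
    refine ⟨min c₀ c₁, lt_min hc₀ hc₁, fun V _ _ _ hV Ω _ μ _ X hX hμ F hFM hF => ?_⟩
    obtain ⟨T, hT, hTp, hTU⟩ := h₀ V hV Ω (μ 0) X hX
    -- the vector `0` is included for the functions that do not depend on the first variable
    set G : Finset V := insert 0 (T.biUnion Prod.snd) with hG
    have hGcard : G.card ≤ N * N + 1 := by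
      refine (Finset.card_insert_le _ _).trans (Nat.succ_le_succ ?_)
      refine (Finset.card_biUnion_le_card_mul _ _ N fun p hp => (hTp p hp).1).trans ?_
      exact Nat.mul_le_mul_right N hT
    let sub : ((Fin (k + 1) → V) → ℝ) × V → (Fin k → V) → ℝ :=
      fun q y => q.1 (Fin.cons q.2 y : Fin (k + 1) → V)
    obtain ⟨Y, hYm, hYμ, hYF⟩ := h₁ V hV Ω (fun i => μ i.succ) X hX (fun i => hμ i.succ)
      ((F ×ˢ G).image sub)
      (Finset.card_image_le.trans (by
        rw [Finset.card_product]
        exact Nat.mul_le_mul hFM hGcard))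
      (by
        simp only [Finset.mem_image, Finset.mem_product]
        rintro _ ⟨⟨f, v⟩, ⟨hf, -⟩, rfl⟩
        exact (hF f hf).cons v)
    have hne : ∀ i, (Y i).Nonempty := fun i => by
      refine Set.nonempty_iff_ne_empty.2 fun h0 => ?_
      have h1 := hYμ i
      rw [h0, measureReal_empty] at h1
      have h2 := mul_pos hc₁ (hμ i.succ)
      linarith
    choose η hη using hne
    have hsub : ∀ f ∈ F, ∀ v ∈ G, ∀ ω : Fin k → Ω, (∀ i, ω i ∈ Y i) →
        SignType.sign (f (Fin.cons v (fun i => X (η i)) : Fin (k + 1) → V)) =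
          SignType.sign (f (Fin.cons v (fun i => X (ω i)) : Fin (k + 1) → V)) :=
      fun f hf v hv ω hω => hYF (sub (f, v))
        (Finset.mem_image_of_mem sub (Finset.mk_mem_product hf hv)) η ω hη hω
    have hdual : ∀ (f : (Fin (k + 1) → V) → ℝ) (y : Fin k → V), ∃ u : Module.Dual ℝ V,
        (∃ u : Module.Dual ℝ V, ∀ v, f (Fin.cons v y : Fin (k + 1) → V) = u v) →
          ∀ v, f (Fin.cons v y : Fin (k + 1) → V) = u v := by
      intro f y
      by_cases h : ∃ u : Module.Dual ℝ V, ∀ v, f (Fin.cons v y : Fin (k + 1) → V) = u v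
      · exact ⟨h.choose, fun _ => h.choose_spec⟩
      · exact ⟨0, fun h' => absurd h' h⟩
    choose D hD using hdual
    obtain ⟨p, hp, hpU⟩ := hTU (F.image fun f => D f fun i => X (η i))
      (Finset.card_image_le.trans hFM)
    refine ⟨Fin.cons p.1 Y, fun i => ?_, fun i => ?_, fun f hf ω ω' hω hω' => ?_⟩
    · refine Fin.cases ?_ (fun j => ?_) i
      · exact (hTp p hp).2.1
      · simpa using hYm j
    · refine Fin.cases ?_ (fun j => ?_) i
      · exact (mul_le_mul_of_nonneg_right (min_le_left _ _) (hμ 0).le).trans (hTp p hp).2.2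
      · simpa using (mul_le_mul_of_nonneg_right (min_le_right c₀ c₁) (hμ j.succ).le).trans (hYμ j)
    · -- every transversal has the same sign as one that starts in `p.1` and continues with `η`
      have key : ∀ ω : Fin (k + 1) → Ω,
          (∀ i, ω i ∈ (Fin.cons p.1 Y : Fin (k + 1) → Set Ω) i) → ∀ ω₁ ∈ p.1,
          SignType.sign (f (Fin.cons (X ω₁) (fun i => X (η i)) : Fin (k + 1) → V)) =
            SignType.sign (f fun i => X (ω i)) := by
        intro ω hω ω₁ hω₁
        have hω0 : ω 0 ∈ p.1 := hω 0
        have hωs : ∀ i : Fin k, ω i.succ ∈ Y i := fun i => by simpa using hω i.succ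
        have hsplit : (fun i => X (ω i)) =
            (Fin.cons (X (ω 0)) (fun i => X (ω i.succ)) : Fin (k + 1) → V) := by
          ext i
          refine Fin.cases rfl (fun j => rfl) i
        rw [hsplit]
        rcases hF f hf 0 with hlin | hconst
        · have hlin' : ∀ y : Fin k → V, ∀ v, f (Fin.cons v y : Fin (k + 1) → V) = D f y v := by
            intro y
            refine hD f y ?_
            obtain ⟨u, hu⟩ := hlin (Fin.cons 0 y : Fin (k + 1) → V)
            exact ⟨u, fun v => by rw [← hu v, Fin.update_cons_zero]⟩
          rw [hlin', hlin']
          refine (hpU _ (Finset.mem_image_of_mem _ hf)).sign_eq (fun v hv => ?_) hω₁ hω0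
          rw [← hlin', ← hlin']
          exact hsub f hf v (Finset.mem_insert_of_mem (Finset.mem_biUnion.2 ⟨p, hp, hv⟩)) _ hωs
        · have hconst' : ∀ (y : Fin k → V) (v : V), f (Fin.cons v y : Fin (k + 1) → V) =
              f (Fin.cons 0 y : Fin (k + 1) → V) := fun y v => by
            simpa only [Fin.update_cons_zero] using hconst (Fin.cons 0 y : Fin (k + 1) → V) v 0
          rw [hconst', hconst' (fun i => X (ω i.succ))]
          exact hsub f hf 0 (Finset.mem_insert_self _ _) _ hωs
      exact (key ω hω (ω 0) (hω 0)).symm.trans (key ω' hω' (ω 0) (hω 0))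

/-! ### Minors and positive circuits -/

/-- The minor of the matrix with rows `x 0, x 1, …` on the rows `a` and the columns `J`. -/
def rowMinor {N d r : ℕ} (a : Fin r → Fin N) (J : Fin r → Fin d) (x : Fin N → Fin d → ℝ) : ℝ :=
  (Matrix.of fun i j => x (a i) (J j)).det

theorem separatelyLinear_rowMinor {N d r : ℕ} {a : Fin r → Fin N} (ha : Function.Injective a)
    (J : Fin r → Fin d) : SeparatelyLinear (rowMinor a J) := by
  intro i
  by_cases hi : ∃ i', a i' = i
  · obtain ⟨i', rfl⟩ := hi
    refine Or.inl fun x => ⟨((Matrix.detRowAlternating (R := ℝ)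
      (n := Fin r)).toMultilinearMap.toLinearMap (fun l j => x (a l) (J j)) i').comp (LinearMap.funLeft ℝ ℝ J), fun v => ?_⟩
    simp only [rowMinor, LinearMap.comp_apply, MultilinearMap.toLinearMap_apply]
    show Matrix.det _ = Matrix.det _
    congr 1
    ext l j
    by_cases hl : l = i'
    · subst hl
      simp
    · simp [Function.update_of_ne hl, Function.update_of_ne (ha.ne hl)]
  · refine Or.inr fun x v w => ?_
    have h : ∀ l, a l ≠ i := fun l hl => hi ⟨l, hl⟩
    simp [rowMinor, Function.update_of_ne (h _)]

theorem exists_rowMinor_ne_zero {d r : ℕ} {z : Fin r → Fin d → ℝ} (hz : LinearIndependent ℝ z) :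
    ∃ J : Fin r → Fin d, rowMinor id J z ≠ 0 := by
  let A : Matrix (Fin r) (Fin d) ℝ := Matrix.of z
  have hrank : A.rank = r := by
    have := LinearIndependent.rank_matrix (M := A) hz
    simpa using this
  obtain ⟨κ, e, he, hspan, hli⟩ := exists_linearIndependent' ℝ A.col
  have : Finite κ := Finite.of_injective e he
  have := Fintype.ofFinite κ
  have hcard : Fintype.card κ = Fintype.card (Fin r) := by
    rw [← finrank_span_eq_card hli, hspan, ← Matrix.rank_eq_finrank_span_cols, hrank,
      Fintype.card_fin]
  let f := Fintype.equivOfCardEq hcard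
  refine ⟨e ∘ f.symm, fun h0 => ?_⟩
  have hli' : LinearIndependent ℝ (Matrix.of fun i j => z (id i) ((e ∘ f.symm) j)).col :=
    hli.comp f.symm f.symm.injective
  rw [Matrix.linearIndependent_cols_iff_isUnit, Matrix.isUnit_iff_isUnit_det] at hli'
  exact hli'.ne_zero h0

/-- Laplace expansion along the first column. -/
theorem rowMinor_cons {d r : ℕ} (z : Fin (r + 1) → Fin d → ℝ) (t : Fin d) (J : Fin r → Fin d) :
    rowMinor id (Fin.cons t J : Fin (r + 1) → Fin d) z =
      ∑ i : Fin (r + 1), (-1) ^ (i : ℕ) * rowMinor i.succAbove J z * z i t := by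
  rw [rowMinor, Matrix.det_succ_column_zero]
  refine Finset.sum_congr rfl fun i _ => ?_
  have : (Matrix.of fun i j => z (id i) ((Fin.cons t J : Fin (r + 1) → Fin d) j)).submatrix
      i.succAbove Fin.succ = Matrix.of fun l j => z (i.succAbove l) (J j) := by
    ext l j; simp
  rw [this, rowMinor]
  simp
  ring

/-- Rows with a nonvanishing maximal minor are linearly independent. -/
theorem eq_zero_of_rowMinor_ne_zero {N d r : ℕ} {a : Fin r → Fin N} {J : Fin r → Fin d}
    {x : Fin N → Fin d → ℝ} (h : rowMinor a J x ≠ 0) {c : Fin r → ℝ}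
    (hc : ∀ t, ∑ l, c l * x (a l) t = 0) : c = 0 := by
  refine Matrix.eq_zero_of_vecMul_eq_zero h ?_
  ext j
  simpa [Matrix.vecMul, dotProduct] using hc (J j)

/-- The dependence of affinely independent points with the origin in the interior of their simplex
is given by maximal minors of one sign, by Cramer's rule. -/
theorem exists_minors_of_positive_circuit {d r : ℕ} {z : Fin (r + 1) → Fin d → ℝ}
    (hz : AffineIndependent ℝ z) {w : Fin (r + 1) → ℝ} (hw : ∀ i, 0 < w i) (hw1 : ∑ i, w i = 1)
    (hwz : ∑ i, w i • z i = 0) :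
    ∃ J : Fin r → Fin d,
      (∀ t, rowMinor id (Fin.cons t J : Fin (r + 1) → Fin d) z = 0) ∧
      ∃ κ : ℝ, κ ≠ 0 ∧ ∀ i : Fin (r + 1), (-1) ^ (i : ℕ) * rowMinor i.succAbove J z = κ * w i := by
  -- all linear dependences are proportional to `w`
  have hprop : ∀ c : Fin (r + 1) → ℝ, ∑ i, c i • z i = 0 → ∀ i, c i = (∑ j, c j) * w i := by
    intro c hc i
    have h := (affineIndependent_iff (k := ℝ) (p := z)).1 hz Finset.univ
      (fun i => c i - (∑ j, c j) * w i)
      (by rw [Finset.sum_sub_distrib, ← Finset.mul_sum, hw1]; ring)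
      (by simp only [sub_smul, mul_smul, Finset.sum_sub_distrib, ← Finset.smul_sum, hc, hwz]; simp)
      i (Finset.mem_univ i)
    simpa [sub_eq_zero] using h
  have hli : LinearIndependent ℝ fun l : Fin r => z l.succ := by
    rw [Fintype.linearIndependent_iff]
    intro c hc
    have h := hprop (Fin.cons 0 c : Fin (r + 1) → ℝ) (by simpa [Fin.sum_univ_succ] using hc)
    have h0 := h 0
    rw [Fin.cons_zero, eq_comm, mul_eq_zero, or_iff_left (hw 0).ne'] at h0
    intro l
    have := h l.succ
    rwa [h0, zero_mul, Fin.cons_succ] at this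
  obtain ⟨J, hJ⟩ := exists_rowMinor_ne_zero hli
  have hdet : ∀ t, rowMinor id (Fin.cons t J : Fin (r + 1) → Fin d) z = 0 := by
    intro t
    by_contra h
    have := eq_zero_of_rowMinor_ne_zero h (c := w) fun t' => by
      simpa using congr_fun hwz t'
    exact (hw 0).ne' (congr_fun this 0)
  refine ⟨J, hdet, ∑ j : Fin (r + 1), (-1) ^ (j : ℕ) * rowMinor j.succAbove J z, ?_, ?_⟩
  · intro hκ
    have h := hprop (fun i : Fin (r + 1) => (-1) ^ (i : ℕ) * rowMinor i.succAbove J z) (by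
      ext t
      simpa [← rowMinor_cons] using hdet t) 0
    rw [hκ, zero_mul] at h
    refine hJ ?_
    simpa [rowMinor] using h
  · refine hprop (fun i : Fin (r + 1) => (-1) ^ (i : ℕ) * rowMinor i.succAbove J z) ?_
    ext t
    simpa [← rowMinor_cons] using hdet t

/-- If maximal minors of one sign give a dependence of the points of `y`, then the origin is in the
convex hull of `y`, and `y` has no repetition: otherwise a proper subfamily with a nonvanishing
minor would be dependent. -/
theorem zero_mem_convexHull_of_minors {d r : ℕ} {y : Fin (r + 1) → Fin d → ℝ} {J : Fin r → Fin d}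
    (h0 : ∀ t, rowMinor id (Fin.cons t J : Fin (r + 1) → Fin d) y = 0) {κ : ℝ}
    (hκ : ∀ i : Fin (r + 1), 0 < κ * ((-1) ^ (i : ℕ) * rowMinor i.succAbove J y)) :
    0 ∈ convexHull ℝ (Set.range y) ∧ Function.Injective y := by
  set β : Fin (r + 1) → ℝ := fun i => κ * ((-1) ^ (i : ℕ) * rowMinor i.succAbove J y) with hβ
  have hdep : ∀ t, ∑ i, β i * y i t = 0 := by
    intro t
    have := h0 t
    rw [rowMinor_cons] at this
    simp only [hβ, mul_assoc κ, ← Finset.mul_sum, this, mul_zero]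
  constructor
  · have hsum : 0 < ∑ i, β i := Finset.sum_pos (fun i _ => hκ i) Finset.univ_nonempty
    have hc : Finset.univ.centerMass β y = 0 := by
      rw [Finset.centerMass]
      have : ∑ i, β i • y i = 0 := by
        ext t
        simpa using hdep t
      rw [this, smul_zero]
    rw [← hc]
    exact Finset.centerMass_mem_convexHull _ (fun i _ => (hκ i).le) hsum
      fun i _ => Set.mem_range_self i
  · intro i j hij
    by_contra hne
    obtain ⟨l, rfl⟩ := Fin.exists_succAbove_eq (Ne.symm hne)
    have hmin : rowMinor i.succAbove J y ≠ 0 := fun h => by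
      have := hκ i
      simp [h] at this
    have hz := eq_zero_of_rowMinor_ne_zero hmin
      (c := fun m => β (i.succAbove m) + if m = l then β i else 0) fun t => by
        have := hdep t
        rw [Fin.sum_univ_succAbove _ i, hij] at this
        simp only [add_mul, ite_mul, zero_mul, Finset.sum_add_distrib, Finset.sum_ite_eq',
          Finset.mem_univ, if_true]
        linarith
    have := congr_fun hz l
    simp only [if_true, Pi.zero_apply] at this
    have h1 := hκ i
    have h2 := hκ (i.succAbove l)
    simp only [hβ] at this
    linarith

/-- Whether the origin is a positive combination of a minimal dependent set of points is detected
by the signs of minors. -/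
theorem positive_circuit_of_sign_eq {d r : ℕ} {y z : Fin (r + 1) → Fin d → ℝ} {J : Fin r → Fin d}
    {w : Fin (r + 1) → ℝ} (hw : ∀ i, 0 < w i) {κ : ℝ} (hκ : κ ≠ 0)
    (h0 : ∀ t, rowMinor id (Fin.cons t J : Fin (r + 1) → Fin d) z = 0)
    (hz : ∀ i : Fin (r + 1), (-1) ^ (i : ℕ) * rowMinor i.succAbove J z = κ * w i)
    (h1 : ∀ t, SignType.sign (rowMinor id (Fin.cons t J : Fin (r + 1) → Fin d) y) =
      SignType.sign (rowMinor id (Fin.cons t J : Fin (r + 1) → Fin d) z))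
    (h2 : ∀ i : Fin (r + 1), SignType.sign (rowMinor i.succAbove J y) =
      SignType.sign (rowMinor i.succAbove J z)) :
    0 ∈ convexHull ℝ (Set.range y) ∧ Function.Injective y := by
  refine zero_mem_convexHull_of_minors (J := J) (κ := κ) (fun t => ?_) fun i => ?_
  · have := h1 t
    rw [h0, sign_zero] at this
    exact sign_eq_zero_iff.1 this
  · rw [← sign_eq_one_iff, sign_mul, sign_mul, h2, ← sign_mul, ← sign_mul, hz, sign_eq_one_iff,
      ← mul_assoc]
    exact mul_pos (mul_self_pos.2 hκ) (hw i)

/-! ### Positive circuits of positive fractions -/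

/-- If every closed halfspace with the origin on its boundary has mass at least `τ`, then for some
`r ≤ d` there are `r + 1` disjoint events of mass at least `c`, all of whose transversals have the
origin in their convex hull. -/
theorem exists_transversal_circuit (d : ℕ) {τ : ℝ} (hτ : 0 < τ) :
    ∃ c : ℝ, 0 < c ∧ ∀ (Ω : Type) [MeasurableSpace Ω] (μ : Measure Ω) [IsProbabilityMeasure μ]
      (X : Ω → Fin d → ℝ), LinMeasurable X →
      (∀ u : Module.Dual ℝ (Fin d → ℝ), τ ≤ μ.real {ω | 0 ≤ u (X ω)}) →
      ∃ r ≤ d, ∃ Z : Fin (r + 1) → Set Ω, (∀ i, MeasurableSet (Z i)) ∧ (∀ i, c ≤ μ.real (Z i)) ∧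
        (Pairwise fun i j => Disjoint (Z i) (Z j)) ∧
        ∀ ω : Fin (r + 1) → Ω, (∀ i, ω i ∈ Z i) →
          0 ∈ convexHull ℝ (Set.range fun i => X (ω i)) := by
  classical
  obtain ⟨N₀, c₀, hc₀, hc₀1, h₀⟩ := exists_avoidedCells d
  obtain ⟨N, c₁, hc₁, h₁⟩ := h₀.exists_containedCells hc₀ hc₀1 hτ
  let F : Finset ((Fin N → Fin d → ℝ) → ℝ) := (Finset.univ : Finset (Σ r : Fin (d + 2),
    {a : Fin (r : ℕ) → Fin N // Function.Injective a} × (Fin (r : ℕ) → Fin d))).image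
      fun p => rowMinor p.2.1.1 p.2.2
  have hmemF : ∀ {r : ℕ} (_ : r < d + 2) {a : Fin r → Fin N} (_ : Function.Injective a)
      (J : Fin r → Fin d), rowMinor a J ∈ F := fun {r} hr {a} ha J =>
    Finset.mem_image.2 ⟨⟨⟨r, hr⟩, ⟨a, ha⟩, J⟩, Finset.mem_univ _, rfl⟩
  obtain ⟨c₂, hc₂, h₂⟩ := exists_constant_signs d N F.card
  refine ⟨c₂ * c₁, by positivity, fun Ω _ μ _ X hX hdepth => ?_⟩
  have hdim : Module.finrank ℝ (Fin d → ℝ) ≤ d := (Module.finrank_fin_fun ℝ).le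
  obtain ⟨T, hT, hTu⟩ := h₁ (Fin d → ℝ) hdim Ω μ X hX (by simp)
  simp only [probReal_univ, mul_one] at hT hTu
  obtain ⟨p₀, hp₀, -⟩ := hTu 0 (hdepth 0)
  -- enumerate the cells, with repetitions
  obtain ⟨P, hP, hPsurj⟩ : ∃ P : Fin N → Set Ω × Finset (Fin d → ℝ), (∀ i, P i ∈ T) ∧
      ∀ p ∈ T, ∃ i, P i = p := by
    have : Nonempty T := ⟨⟨p₀, hp₀⟩⟩
    obtain ⟨f⟩ : Nonempty (T ↪ Fin N) := by
      rw [Function.Embedding.nonempty_iff_card_le]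
      simpa using hT.card_le
    refine ⟨fun i => (Function.invFun f i).1, fun i => (Function.invFun f i).2, fun p hp =>
      ⟨f ⟨p, hp⟩, ?_⟩⟩
    simp [Function.leftInverse_invFun f.injective _]
  have hPm : ∀ i, MeasurableSet (P i).1 := fun i => hT.meas _ (hP i)
  have hPmass : ∀ i, c₁ ≤ (μ.restrict (P i).1).real Set.univ := fun i => by
    rw [measureReal_restrict_apply MeasurableSet.univ, Set.univ_inter]
    exact hT.mass_le _ (hP i)
  obtain ⟨Y, hYm, hYμ, hYF⟩ := h₂ (Fin d → ℝ) hdim Ω (fun i => μ.restrict (P i).1) X hX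
    (fun i => hc₁.trans_le (hPmass i)) F le_rfl (by
      simp only [F, Finset.forall_mem_image]
      exact fun p _ => separatelyLinear_rowMinor p.2.1.2 p.2.2)
  have hZmass : ∀ i, c₂ * c₁ ≤ μ.real (Y i ∩ (P i).1) := fun i => by
    have := (mul_le_mul_of_nonneg_left (hPmass i) hc₂.le).trans (hYμ i)
    rwa [measureReal_restrict_apply (hYm i)] at this
  have hne : ∀ i, (Y i ∩ (P i).1).Nonempty := fun i => by
    refine Set.nonempty_iff_ne_empty.2 fun h0 => ?_
    have h1 := hZmass i
    rw [h0, measureReal_empty] at h1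
    have := mul_pos hc₂ hc₁
    linarith
  choose η hη using hne
  -- a hyperplane strictly separating a transversal from the origin contradicts the choice of cells
  have hhull : (0 : Fin d → ℝ) ∈ convexHull ℝ (Set.range fun i => X (η i)) := by
    by_contra hnot
    obtain ⟨f, b, hf1, hf2⟩ := geometric_hahn_banach_closed_point (convex_convexHull ℝ _)
      ((Set.finite_range fun i => X (η i)).isCompact_convexHull ℝ).isClosed hnot
    obtain ⟨p, hp, hpos⟩ := hTu (f : (Fin d → ℝ) →ₗ[ℝ] ℝ) (hdepth _)
    obtain ⟨i, rfl⟩ := hPsurj p hp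
    have h1 := (hT.mem _ hp (η i) (hη i).2 _ hpos).1
    have h2 := hf1 (X (η i)) (subset_convexHull ℝ _ (Set.mem_range_self i))
    rw [map_zero] at hf2
    simp only [ContinuousLinearMap.coe_coe] at h1
    linarith
  obtain ⟨ι, _, z, w, hzr, hzi, hw, hw1, hwz⟩ := eq_pos_convex_span_of_mem_convexHull hhull
  have hcard : Fintype.card ι ≤ d + 1 := by
    have := hzi.card_le_finrank_succ
    have h2 := Submodule.finrank_le (vectorSpan ℝ (Set.range z))
    omega
  have hcard0 : Fintype.card ι ≠ 0 := fun h0 => by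
    have := Fintype.card_eq_zero_iff.1 h0
    simp at hw1
  obtain ⟨r, hr⟩ := Nat.exists_eq_succ_of_ne_zero hcard0
  let e : Fin (r + 1) ≃ ι := (Fintype.equivFinOfCardEq hr).symm
  have hzi' : AffineIndependent ℝ (z ∘ e) := hzi.comp_embedding e.toEmbedding
  choose a ha using fun i : Fin (r + 1) => hzr (Set.mem_range_self (e i))
  have ha : ∀ i, X (η (a i)) = z (e i) := ha
  have hainj : Function.Injective a := fun i j hij => by
    refine hzi'.injective ?_
    simp only [Function.comp_apply, ← ha, hij]
  have hrd : r ≤ d := by omega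
  obtain ⟨J, hJ0, κ, hκ, hJ⟩ := exists_minors_of_positive_circuit hzi' (w := w ∘ e)
    (fun i => hw (e i)) (by rw [← hw1]; exact e.sum_comp w)
    (by rw [← hwz]; exact e.sum_comp fun i => w i • z i)
  have hmain : ∀ ω : Fin (r + 1) → Ω, (∀ i, ω i ∈ Y (a i) ∩ (P (a i)).1) →
      0 ∈ convexHull ℝ (Set.range fun i => X (ω i)) ∧ Function.Injective fun i => X (ω i) := by
    intro ω hω
    let ω' : Fin N → Ω := Function.extend a ω η
    have hω'a : ∀ i, ω' (a i) = ω i := fun i => hainj.extend_apply ω η i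
    have hω' : ∀ i, ω' i ∈ Y i := fun i => by
      by_cases hi : ∃ j, a j = i
      · obtain ⟨j, rfl⟩ := hi
        rw [hω'a]
        exact (hω j).1
      · rw [show ω' i = η i from Function.extend_apply' ω η i hi]
        exact (hη i).1
    have hsign := fun f hf => hYF f hf ω' η hω' fun i => (hη i).1
    have hy : (fun i => X (ω i)) = fun i => X (ω' (a i)) := by
      ext1 i
      rw [hω'a]
    have hz : z ∘ e = fun i => X (η (a i)) := by
      ext1 i
      rw [ha, Function.comp_apply]
    rw [hz] at hJ0 hJ
    rw [hy]
    exact positive_circuit_of_sign_eq (fun i => hw (e i)) hκ hJ0 hJ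
      (fun t => hsign _ (hmemF (show r + 1 < d + 2 by omega) hainj _))
      fun i => hsign _ (hmemF (show r < d + 2 by omega)
        (hainj.comp Fin.succAbove_right_injective) J)
  refine ⟨r, hrd, fun i => Y (a i) ∩ (P (a i)).1, fun i => (hYm _).inter (hPm _),
    fun i => hZmass _, fun i j hij => ?_, fun ω hω => (hmain ω hω).1⟩
  -- a common point of two of the sets would be repeated in some transversal
  refine Set.disjoint_left.2 fun x hxi hxj => hij ?_
  refine (hmain (fun l => if l = i ∨ l = j then x else η (a l)) fun l => ?_).2 (by simp)
  by_cases hl : l = i ∨ l = j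
  · rw [if_pos hl]
    rcases hl with rfl | rfl
    · exact hxi
    · exact hxj
  · rw [if_neg hl]
    exact hη (a l)

/-! ### Splitting off further disjoint sets -/

section Splitting
variable {d : ℕ} {μ : Measure (EuclideanSpace ℝ (Fin d))}

/-- If the coordinate medians of `Z` do not split it into two substantial parts, then almost all of
its mass sits at one point. -/
theorem exists_subset_of_atoms_le [IsFiniteMeasure μ] (hd : 1 ≤ d)
    {Z : Set (EuclideanSpace ℝ (Fin d))}
    (hZ : MeasurableSet Z) {δ : ℝ} (hδ : 0 < δ) (hatom : ∀ x, μ.real {x} + δ ≤ μ.real Z) :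
    ∃ B ⊆ Z, MeasurableSet B ∧ δ / (2 * d) ≤ μ.real B ∧ δ / (2 * d) ≤ μ.real (Z \ B) := by
  have hd' : (1 : ℝ) ≤ d := by exact_mod_cast hd
  have hcoord : ∀ i : Fin d, Measurable fun x : EuclideanSpace ℝ (Fin d) => x i := fun i => by
    fun_prop
  have hδd : δ / (2 * d) ≤ δ / 2 := by
    apply div_le_div_of_nonneg_left hδ.le (by norm_num)
    linarith
  have hZδ : δ ≤ μ.real Z := by
    have := hatom 0
    have := measureReal_nonneg (μ := μ) (s := {(0 : EuclideanSpace ℝ (Fin d))})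
    linarith
  choose b hb1 hb2 using fun i => exists_median (μ.restrict Z) (hcoord i)
  have hr : ∀ {A : Set (EuclideanSpace ℝ (Fin d))}, MeasurableSet A →
      (μ.restrict Z).real A = μ.real (Z ∩ A) := fun hA => by
    rw [measureReal_restrict_apply hA, Set.inter_comm]
  have hlt : ∀ i, MeasurableSet {x : EuclideanSpace ℝ (Fin d) | x i < b i} := fun i =>
    measurableSet_lt (hcoord i) measurable_const
  have hgt : ∀ i, MeasurableSet {x : EuclideanSpace ℝ (Fin d) | b i < x i} := fun i =>
    measurableSet_lt measurable_const (hcoord i)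
  have hsplit : ∀ A : Set (EuclideanSpace ℝ (Fin d)), MeasurableSet A →
      (μ.restrict Z).real A ≤ (μ.restrict Z).real Set.univ / 2 →
      δ / (2 * d) ≤ (μ.restrict Z).real A →
      ∃ B ⊆ Z, MeasurableSet B ∧ δ / (2 * d) ≤ μ.real B ∧ δ / (2 * d) ≤ μ.real (Z \ B) := by
    intro A hA h1 h2
    rw [hr hA] at h1 h2
    rw [hr MeasurableSet.univ, Set.inter_univ] at h1
    refine ⟨Z ∩ A, Set.inter_subset_left, hZ.inter hA, h2, ?_⟩
    have := measureReal_sdiff_add_inter (μ := μ) (s := Z) hA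
    rw [Set.sdiff_self_inter]
    linarith
  by_contra hno
  have h1 : ∀ i, (μ.restrict Z).real {x | x i < b i} < δ / (2 * d) := fun i => by
    by_contra! h
    exact hno (hsplit _ (hlt i) (hb1 i) h)
  have h2 : ∀ i, (μ.restrict Z).real {x | b i < x i} < δ / (2 * d) := fun i => by
    by_contra! h
    exact hno (hsplit _ (hgt i) (hb2 i) h)
  have hcover : (Set.univ : Set (EuclideanSpace ℝ (Fin d))) ⊆
      {WithLp.toLp 2 b} ∪ ⋃ i, ({x | x i < b i} ∪ {x | b i < x i}) := by
    intro x _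
    by_cases hx : x = WithLp.toLp 2 b
    · exact Or.inl hx
    · right
      obtain ⟨i, hi⟩ : ∃ i, x i ≠ b i := by
        by_contra! h
        exact hx (by ext i; simpa using h i)
      exact Set.mem_iUnion.2 ⟨i, lt_or_gt_of_ne hi⟩
  have h3 := (measureReal_mono (μ := μ.restrict Z) hcover).trans (measureReal_union_le _ _)
  have h4 := measureReal_iUnion_fintype_le (μ := μ.restrict Z)
    fun i => ({x : EuclideanSpace ℝ (Fin d) | x i < b i} ∪ {x | b i < x i})
  have h5 : ∑ i : Fin d, (μ.restrict Z).real
      ({x : EuclideanSpace ℝ (Fin d) | x i < b i} ∪ {x | b i < x i}) < ∑ _i : Fin d, δ / d := by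
    refine Finset.sum_lt_sum_of_nonempty ⟨⟨0, hd⟩, Finset.mem_univ _⟩ fun i _ => ?_
    refine (measureReal_union_le _ _).trans_lt ?_
    have : δ / d = δ / (2 * d) + δ / (2 * d) := by field_simp; norm_num
    rw [this]
    exact add_lt_add (h1 i) (h2 i)
  have h6 : ∑ _i : Fin d, δ / (d : ℝ) = δ := by
    rw [Finset.sum_const, Finset.card_univ, Fintype.card_fin, nsmul_eq_mul]
    field_simp
  have h7 : (μ.restrict Z).real {WithLp.toLp 2 b} ≤ μ.real {WithLp.toLp 2 b} := by
    rw [hr (measurableSet_singleton _)]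
    exact measureReal_mono Set.inter_subset_right
  have h8 := hatom (WithLp.toLp 2 b)
  rw [hr MeasurableSet.univ, Set.inter_univ] at h3
  linarith

/-- One more disjoint set can be added. If the complement of the given sets is too light for that,
then one of them is heavier than an atom by a fixed amount, and it can be split. -/
theorem exists_extra_disjoint_set [IsProbabilityMeasure μ] (hd : 1 ≤ d) {c : ℝ}
    (hc : c ≤ 1 / (4 * (d : ℝ) ^ 2 * (d + 1))) (hatom : ∀ x, μ.real {x} ≤ 1 / ((d : ℝ) + 1))
    {j : ℕ} (hj : j ≤ d) {Z : Fin j → Set (EuclideanSpace ℝ (Fin d))}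
    (hZ : ∀ i, MeasurableSet (Z i)) (hZc : ∀ i, c ≤ μ.real (Z i))
    (hZd : Pairwise fun i j => Disjoint (Z i) (Z j)) :
    ∃ Y : Fin (j + 1) → Set (EuclideanSpace ℝ (Fin d)), (∀ i, MeasurableSet (Y i)) ∧
      (∀ i, c ≤ μ.real (Y i)) ∧ (Pairwise fun i j => Disjoint (Y i) (Y j)) ∧
      ∀ i, Y i.castSucc ⊆ Z i := by
  classical
  have hd' : (1 : ℝ) ≤ d := by exact_mod_cast hd
  set δ : ℝ := 1 / (2 * d * (d + 1)) with hδ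
  have hδ0 : 0 < δ := by positivity
  have hδc : δ / (2 * d) = 1 / (4 * (d : ℝ) ^ 2 * (d + 1)) := by
    rw [hδ]; field_simp; ring
  have hsnoc : ∀ (Z' : Fin j → Set (EuclideanSpace ℝ (Fin d))) (E : Set (EuclideanSpace ℝ (Fin d))),
      (∀ i, MeasurableSet (Z' i)) → (∀ i, c ≤ μ.real (Z' i)) →
      (Pairwise fun i j => Disjoint (Z' i) (Z' j)) → (∀ i, Z' i ⊆ Z i) → MeasurableSet E →
      c ≤ μ.real E → (∀ i, Disjoint (Z' i) E) →
      ∃ Y : Fin (j + 1) → Set (EuclideanSpace ℝ (Fin d)), (∀ i, MeasurableSet (Y i)) ∧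
        (∀ i, c ≤ μ.real (Y i)) ∧ (Pairwise fun i j => Disjoint (Y i) (Y j)) ∧
        ∀ i, Y i.castSucc ⊆ Z i := by
    intro Z' E h1 h2 h3 h4 h5 h6 h7
    refine ⟨Fin.snoc Z' E, fun i => ?_, fun i => ?_, fun i i' hii' => ?_, fun i => ?_⟩
    · refine Fin.lastCases ?_ (fun i => ?_) i
      · simpa using h5
      · simpa using h1 i
    · refine Fin.lastCases ?_ (fun i => ?_) i
      · simpa using h6
      · simpa using h2 i
    · induction i using Fin.lastCases with
      | last =>
        induction i' using Fin.lastCases with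
        | last => exact absurd rfl hii'
        | cast i' => simpa using (h7 i').symm
      | cast i =>
        induction i' using Fin.lastCases with
        | last => simpa using h7 i
        | cast i' => simpa using h3 fun h => hii' (by rw [h])
    · simpa using h4 i
  have hUm : MeasurableSet (⋃ i, Z i) := MeasurableSet.iUnion hZ
  by_cases hR : δ ≤ μ.real (⋃ i, Z i)ᶜ
  · refine hsnoc Z _ hZ hZc hZd (fun i => subset_rfl) hUm.compl ?_ fun i =>
      Set.disjoint_compl_right_iff_subset.2 (Set.subset_iUnion Z i)
    refine (hc.trans hδc.ge).trans (le_trans ?_ hR)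
    exact div_le_self hδ0.le (by linarith)
  push Not at hR
  obtain ⟨i, hi⟩ : ∃ i, 1 / ((d : ℝ) + 1) + δ ≤ μ.real (Z i) := by
    by_contra! h
    have h1 := measureReal_add_measureReal_compl (μ := μ) hUm
    rw [probReal_univ] at h1
    have h2 := measureReal_iUnion_fintype_le (μ := μ) Z
    have h3 : ∑ i, μ.real (Z i) ≤ ∑ _i : Fin j, (1 / ((d : ℝ) + 1) + δ) :=
      Finset.sum_le_sum fun i _ => (h i).le
    rw [Finset.sum_const, Finset.card_univ, Fintype.card_fin, nsmul_eq_mul] at h3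
    have h4 : (j : ℝ) ≤ d := by exact_mod_cast hj
    have h5 : (j : ℝ) * (1 / ((d : ℝ) + 1) + δ) ≤ d * (1 / ((d : ℝ) + 1) + δ) :=
      mul_le_mul_of_nonneg_right h4 (by positivity)
    have h6 : (d : ℝ) * (1 / ((d : ℝ) + 1) + δ) + δ ≤ 1 := by
      have h7 : (d : ℝ) * (1 / ((d : ℝ) + 1) + δ) + δ = d / (d + 1) + (d + 1) * δ := by ring
      have h8 : ((d : ℝ) + 1) * δ = 1 / (2 * d) := by rw [hδ]; field_simp
      rw [h7, h8, div_add_div _ _ (by positivity) (by positivity), div_le_one (by positivity)]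
      nlinarith
    linarith
  obtain ⟨B, hBZ, hB, hB1, hB2⟩ := exists_subset_of_atoms_le hd (hZ i) hδ0
    fun x => (add_le_add_left (hatom x) δ).trans hi
  rw [hδc] at hB1 hB2
  have hsub : ∀ l, Function.update Z i B l ⊆ Z l := fun l => by
    by_cases hl : l = i
    · subst hl
      simpa using hBZ
    · simp [hl]
  refine hsnoc (Function.update Z i B) (Z i \ B) (fun l => ?_) (fun l => ?_) (fun l l' hl => ?_) hsub
    ((hZ i).diff hB) (hc.trans hB2) fun l => ?_
  · by_cases hl : l = i
    · subst hl
      simpa using hB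
    · simpa [hl] using hZ l
  · by_cases hl : l = i
    · subst hl
      simpa using hc.trans hB1
    · simpa [hl] using hZc l
  · exact (hZd hl).mono (hsub l) (hsub l')
  · by_cases hl : l = i
    · subst hl
      simpa using Set.disjoint_sdiff_right
    · exact (hZd hl).mono (hsub l) Set.sdiff_subset

/-- The bound on `c` is the mass of the parts produced by `exists_extra_disjoint_set`, so it is not
lost in repeated applications. -/
theorem exists_disjoint_completion [IsProbabilityMeasure μ] (hd : 1 ≤ d) {c : ℝ}
    (hc : c ≤ 1 / (4 * (d : ℝ) ^ 2 * (d + 1))) (hatom : ∀ x, μ.real {x} ≤ 1 / ((d : ℝ) + 1))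
    {j : ℕ} {Z : Fin j → Set (EuclideanSpace ℝ (Fin d))}
    (hZ : ∀ i, MeasurableSet (Z i)) (hZc : ∀ i, c ≤ μ.real (Z i))
    (hZd : Pairwise fun i j => Disjoint (Z i) (Z j)) {m : ℕ} (hjm : j ≤ m) (hm : m ≤ d + 1) :
    ∃ Y : Fin m → Set (EuclideanSpace ℝ (Fin d)), (∀ i, MeasurableSet (Y i)) ∧
      (∀ i, c ≤ μ.real (Y i)) ∧ (Pairwise fun i j => Disjoint (Y i) (Y j)) ∧
      ∀ i, Y (Fin.castLE hjm i) ⊆ Z i := by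
  induction m, hjm using Nat.le_induction with
  | base => exact ⟨Z, hZ, hZc, hZd, fun i => subset_rfl⟩
  | succ m hjm ih =>
    obtain ⟨Y, h1, h2, h3, h4⟩ := ih (by omega)
    obtain ⟨Y', h1', h2', h3', h4'⟩ := exists_extra_disjoint_set hd hc hatom (by omega) h1 h2 h3
    exact ⟨Y', h1', h2', h3', fun i => (h4' (Fin.castLE hjm i)).trans (h4 i)⟩

end Splitting

/-! ### Depth Carathéodory for measures and for finite sets -/

/-- The common form of both parts of the theorem: only a lower bound on the depth is needed. -/
theorem exists_transversal_sets (d : ℕ) (hd : 1 ≤ d) {τ : ℝ} (hτ : 0 < τ) :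
    ∃ c : ℝ, 0 < c ∧ ∀ (μ : Measure (EuclideanSpace ℝ (Fin d))) [IsProbabilityMeasure μ]
      (q : EuclideanSpace ℝ (Fin d)),
      (∀ H, IsClosedHalfspace H → q ∈ H → τ ≤ μ.real H) →
      ∃ Y : Fin (d + 1) → Set (EuclideanSpace ℝ (Fin d)),
        (∀ i, MeasurableSet (Y i)) ∧
        ((∀ x, μ.real {x} ≤ 1 / ((d : ℝ) + 1)) → Pairwise fun i j => Disjoint (Y i) (Y j)) ∧
        (∀ i, c ≤ μ.real (Y i)) ∧ InEveryTransversalHull q Y := by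
  obtain ⟨c, hc, h⟩ := exists_transversal_circuit d hτ
  set c' := min c (1 / (4 * (d : ℝ) ^ 2 * (d + 1))) with hc'
  have hd0 : (0 : ℝ) < d := by exact_mod_cast hd
  refine ⟨c', by positivity, fun μ _ q hdepth => ?_⟩
  let X : EuclideanSpace ℝ (Fin d) → Fin d → ℝ := fun x => WithLp.ofLp (x - q)
  have hX : LinMeasurable X := fun u =>
    ((LinearMap.continuous_of_finiteDimensional u).comp
      ((PiLp.continuous_ofLp 2 _).comp (continuous_id.sub continuous_const))).measurable
  have hinner : ∀ (w : EuclideanSpace ℝ (Fin d)), w ≠ 0 →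
      τ ≤ μ.real {x | inner ℝ w q ≤ inner ℝ w x} := fun w hw =>
    hdepth _ ⟨w, _, hw, rfl⟩ (le_refl (inner ℝ w q))
  have hτ1 : τ ≤ 1 :=
    (hinner (EuclideanSpace.single ⟨0, hd⟩ 1) (by simp)).trans measureReal_le_one
  have hdual : ∀ u : Module.Dual ℝ (Fin d → ℝ), τ ≤ μ.real {x | 0 ≤ u (X x)} := by
    intro u
    by_cases hu : u = 0
    · simpa [hu] using hτ1
    let w : EuclideanSpace ℝ (Fin d) := WithLp.toLp 2 fun j => u (Pi.single j 1)
    have huw : ∀ v : EuclideanSpace ℝ (Fin d), inner ℝ w v = u (WithLp.ofLp v) := fun v => by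
      rw [LinearMap.pi_apply_eq_sum_univ u]
      simp only [PiLp.inner_apply, w]
      refine Finset.sum_congr rfl fun j _ => ?_
      have hj : (fun j' => if j = j' then (1 : ℝ) else 0) = Pi.single j 1 := by
        ext j'
        simp [Pi.single_apply, eq_comm]
      rw [hj]
      simp
    have hw : w ≠ 0 := fun h0 => hu (LinearMap.ext fun v => by
      have := huw (WithLp.toLp 2 v)
      rw [h0, inner_zero_left] at this
      simpa using this.symm)
    refine (hinner w hw).trans_eq ?_
    congr 1
    ext x
    simp only [Set.mem_ofPred_eq, X]
    rw [← huw, inner_sub_right, sub_nonneg]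
  obtain ⟨r, hr, Z, hZ, hZc, hZd, hZhull⟩ := h _ μ X hX hdual
  -- any sets that include subsets of all the `Z i` inherit the hull property
  have hhull : ∀ (Y : Fin (d + 1) → Set (EuclideanSpace ℝ (Fin d))) (f : Fin (r + 1) → Fin (d + 1)),
      (∀ i, Y (f i) ⊆ Z i) → InEveryTransversalHull q Y := by
    intro Y f hf x hx
    let φ : (Fin d → ℝ) →ᵃ[ℝ] EuclideanSpace ℝ (Fin d) :=
      (WithLp.linearEquiv 2 ℝ (Fin d → ℝ)).symm.toLinearMap.toAffineMap +
        AffineMap.const ℝ (Fin d → ℝ) q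
    have hφ : ∀ v, φ v = WithLp.toLp 2 v + q := fun v => rfl
    have h1 := Set.mem_image_of_mem φ (hZhull (fun i => x (f i)) fun i => hf i (hx (f i)))
    rw [AffineMap.image_convexHull, hφ, WithLp.toLp_zero, zero_add] at h1
    refine convexHull_mono ?_ h1
    rintro _ ⟨_, ⟨i, rfl⟩, rfl⟩
    refine ⟨f i, ?_⟩
    simp [hφ, X]
  by_cases hatom : ∀ x, μ.real {x} ≤ 1 / ((d : ℝ) + 1)
  · obtain ⟨Y, h1, h2, h3, h4⟩ := exists_disjoint_completion hd (min_le_right _ _) hatom hZ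
      (fun i => (min_le_left c _).trans (hZc i)) hZd (Nat.succ_le_succ hr) le_rfl
    exact ⟨Y, h1, fun _ => h3, h2, hhull Y _ h4⟩
  · refine ⟨fun i => if hi : (i : ℕ) < r + 1 then Z ⟨i, hi⟩ else Z 0, fun i => ?_,
      fun h => absurd h hatom, fun i => ?_, hhull _ (Fin.castLE (Nat.succ_le_succ hr)) fun i => ?_⟩
    · dsimp only
      split_ifs
      exacts [hZ _, hZ _]
    · dsimp only
      split_ifs
      exacts [(min_le_left _ _).trans (hZc _), (min_le_left _ _).trans (hZc _)]
    · rw [dif_pos (show (Fin.castLE (Nat.succ_le_succ hr) i : ℕ) < r + 1 from i.2)]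
      rfl

theorem measureReal_uniformOn_finset {d : ℕ} (X : Finset (EuclideanSpace ℝ (Fin d)))
    (A : Set (EuclideanSpace ℝ (Fin d))) :
    (ProbabilityTheory.uniformOn (X : Set (EuclideanSpace ℝ (Fin d)))).real A =
      (((X : Set (EuclideanSpace ℝ (Fin d))) ∩ A).ncard : ℝ) / X.card := by
  have hfin : ((X : Set (EuclideanSpace ℝ (Fin d))) ∩ A).Finite := X.finite_toSet.inter_of_left A
  rw [ProbabilityTheory.uniformOn, measureReal_def,
    ProbabilityTheory.cond_apply X.measurableSet, Measure.count_apply_finset,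
    Measure.count_apply_finite _ hfin, ENNReal.toReal_mul,
    ENNReal.toReal_inv, ENNReal.toReal_natCast, ENNReal.toReal_natCast,
    ← Set.ncard_eq_toFinset_card _ hfin, inv_mul_eq_div]

theorem theorem2 (d : ℕ) (hd : 1 ≤ d) (τ : ℝ) (hτ : 0 < τ) :
    ∃ c : ℝ, 0 < c ∧
      -- finite point sets
      (∀ (X : Finset (EuclideanSpace ℝ (Fin d))) (q : EuclideanSpace ℝ (Fin d)),
        tukeyDepth X q = τ →
        ∃ Y : Fin (d + 1) → Finset (EuclideanSpace ℝ (Fin d)),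
          (∀ i, Y i ⊆ X) ∧
          (d + 1 ≤ X.card → Pairwise fun i j => Disjoint (Y i) (Y j)) ∧
          (∀ i, c * (X.card : ℝ) ≤ ((Y i).card : ℝ)) ∧
          InEveryTransversalHull q (fun i => (Y i : Set (EuclideanSpace ℝ (Fin d))))) ∧
      -- Borel probability measures
      (∀ (μ : Measure (EuclideanSpace ℝ (Fin d))) [IsProbabilityMeasure μ]
        (q : EuclideanSpace ℝ (Fin d)),
        measureTukeyDepth μ q = τ →
        ∃ Y : Fin (d + 1) → Set (EuclideanSpace ℝ (Fin d)),
          (∀ i, MeasurableSet (Y i)) ∧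
          ((∀ x, μ.real {x} ≤ 1 / ((d : ℝ) + 1)) → Pairwise fun i j => Disjoint (Y i) (Y j)) ∧
          (∀ i, c ≤ μ.real (Y i)) ∧
          InEveryTransversalHull q Y) := by
  classical
  obtain ⟨c, hc, h⟩ := exists_transversal_sets d hd hτ
  refine ⟨c, hc, fun X q hq => ?_, fun μ _ q hq => h μ q fun H hH hqH => ?_⟩
  · -- the depth of `q` in the empty set is `0 / 0 = 0`
    have hcard : 0 < X.card := by
      refine Nat.pos_of_ne_zero fun h0 => hτ.ne' ?_
      rw [← hq, tukeyDepth, h0, Nat.cast_zero, div_zero]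
    have hcard' : (0 : ℝ) < X.card := by exact_mod_cast hcard
    have : IsProbabilityMeasure
        (ProbabilityTheory.uniformOn (X : Set (EuclideanSpace ℝ (Fin d)))) :=
      ProbabilityTheory.isProbabilityMeasure_uniformOn X.finite_toSet
        (Finset.coe_nonempty.2 (Finset.card_pos.1 hcard))
    obtain ⟨Y, -, hYd, hYc, hYhull⟩ := h (ProbabilityTheory.uniformOn (X : Set _)) q
      fun H hH hqH => by
        rw [measureReal_uniformOn_finset, ← hq, tukeyDepth]
        have : tukeyCount X q ≤ ((X : Set (EuclideanSpace ℝ (Fin d))) ∩ H).ncard :=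
          Nat.sInf_le ⟨H, hH, hqH, rfl⟩
        gcongr
    refine ⟨fun i => X.filter (· ∈ Y i), fun i => Finset.filter_subset _ _, fun hXd => ?_,
      fun i => ?_, fun x hx => hYhull x fun i => ?_⟩
    · have hdisj := hYd fun x => by
        rw [measureReal_uniformOn_finset]
        have h1 : ((X : Set (EuclideanSpace ℝ (Fin d))) ∩ {x}).ncard ≤ 1 :=
          (Set.ncard_le_ncard Set.inter_subset_right).trans (Set.ncard_singleton x).le
        have h2 : (d : ℝ) + 1 ≤ X.card := by exact_mod_cast hXd
        have h3 : (((X : Set (EuclideanSpace ℝ (Fin d))) ∩ {x}).ncard : ℝ) ≤ 1 := by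
          exact_mod_cast h1
        exact div_le_div₀ one_pos.le h3 (by positivity) h2
      intro i j hij
      refine Finset.disjoint_left.2 fun x hxi hxj => ?_
      exact Set.disjoint_left.1 (hdisj hij) (Finset.mem_filter.1 hxi).2 (Finset.mem_filter.1 hxj).2
    · have h1 := hYc i
      rw [measureReal_uniformOn_finset, le_div_iff₀ hcard'] at h1
      have h2 : (X : Set (EuclideanSpace ℝ (Fin d))) ∩ Y i =
          ((X.filter (· ∈ Y i) : Finset _) : Set (EuclideanSpace ℝ (Fin d))) := by
        ext x
        simp
      rwa [h2, Set.ncard_coe_finset] at h1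
    · exact (Finset.mem_filter.1 (hx i)).2
  · rw [← hq, measureTukeyDepth]
    refine csInf_le ⟨0, ?_⟩ ⟨H, hH, hqH, rfl⟩
    rintro _ ⟨H', -, -, rfl⟩
    exact measureReal_nonneg
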